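/- For $\tau$ in the upper half-plane $\mathfrak h$ let $\theta_\tau(z)=\sum_{n\in\mathbb Z}(-1)^n q^{\frac12(n+\frac12)^2}w^{n+\frac12}$ with $q=e^{2\pi i\tau}$, $w=e^{2\pi iz}$ (so $w^{n+\frac12}=e^{2\pi i z(n+\frac12)}$ and $q^{\frac12(n+\frac12)^2}=e^{\pi i\tau(n+\frac12)^2}$), and define $f_\tau^{(n)}(z)$, $n\ge 0$, by the Laurent expansion at $\alpha=0$ $$\frac{\theta_\tau(z+\alpha)\,\theta_\tau'(0)}{\theta_\tau(z)\,\theta_\tau(\alpha)}=\sum_{n\ge 0}f_\tau^{(n)}(z)\,\alpha^{n-1}.$$ If $f(\epsilon)=\sum_{n=0}^N c_n(\log(-2\pi i\epsilon))^n+O(\epsilon^\delta)$ as $\epsilon\to0^+$ for some $N\ge 0$, $\delta>0$ and $c_0,\dots,c_N\in\mathbb C$, where $\log(-i)=-\frac{\pi i}{2}$, put $\mathrm{Reg}_{\epsilon\to0}f(\epsilon):=c_0$. For $r\ge0$ and $k_1,\dots,k_r\ge0$ the regularized elliptic multiple zeta value is $$I^A(k_1,\dots,k_r;\tau):=\mathrm{Reg}_{\epsilon\to0}\int_{\epsilon<z_1<\cdots<z_r<1-\epsilon}f_\tau^{(k_1)}(z_1)\,dz_1\cdots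 f_\tau^{(k_r)}(z_r)\,dz_r,$$ with $I^A(\emptyset;\tau)=1$. (The expansion exists for every index and every $\tau$, so this is well defined.) Regard the $I^A(k_1,\dots,k_r;\tau)$ either as functions of $\tau\in\mathfrak h$ or, for any fixed $\tau\in\mathfrak h$, as complex numbers. Let $\mathcal{E}^A\mathcal{Z}$ be the $\mathbb Q$-linear span of all of them, and $\mathcal{E}^A\mathcal{Z}_{\mathrm{adm}}$ the $\mathbb Q$-linear span of those with admissible index, i.e. $k_1\ne1$ and $k_r\ne1$ (the empty index being admissible). **Theorem.** The product of two of these values is given by the shuffle product of their indices, $$I^A(\mathbf k;\tau)\,I^A(\mathbf l;\tau)=\sum_{\mathbf m}I^A(\mathbf m;\tau),$$ where $\mathbf m$ runs, with multiplicity, over the terms of the shuffle product of $\mathbf k$ and $\mathbf l$. The spaces $\mathcal{E}^A\mathcal{Z}$ and $\mathcal{E}^A\mathcal{Z}_{\mathrm{adm}}$ are $\mathbb Q$-algebras under this product, and, as $\mathbb Q$-algebras, $$\mathcal{E}^A\mathcal{Z}=\mathcal{E}^A\mathcal{Z}_{\mathrm{adm}}\bigl[\,I^A(k_1,\dots,k_r;\tau)\;\big|\;r\ge0,\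 k_1,\dots,k_r\in\{0,1\}\,\bigr].$$ In particular every regularized elliptic multiple zeta value is a polynomial with rational coefficients in elliptic multiple zeta values with admissible index and ones whose indices lie in $\{0,1\}$. -/

import Mathlib

open scoped UpperHalfPlane

noncomputable section

namespace EllipticMZV

open Filter Topology Asymptotics

/-- The odd Jacobi theta function
`θ_τ(z) = ∑_{n ∈ ℤ} (-1)^n q^{(n+1/2)^2/2} w^{n+1/2}` with `q = e^{2πiτ}`, `w = e^{2πiz}`. -/
def theta (τ : ℍ) (z : ℂ) : ℂ :=
  ∑' n : ℤ, (-1 : ℂ) ^ n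
    * Complex.exp (2 * Real.pi * Complex.I * (τ : ℂ) * (((n : ℂ) + 1 / 2) ^ 2 / 2))
    * Complex.exp (2 * Real.pi * Complex.I * z * ((n : ℂ) + 1 / 2))

/-- The Eisenstein-Kronecker series
`F_τ(α, z) = θ_τ(z + α) θ_τ'(0) / (θ_τ(z) θ_τ(α))`. -/
def eisensteinKronecker (τ : ℍ) (α z : ℂ) : ℂ :=
  theta τ (z + α) * deriv (theta τ) 0 / (theta τ z * theta τ α)

/-- The function `α ↦ α F_τ(α, z)`, with its removable singularity at `α = 0` removed. -/
def alphaEisensteinKronecker (τ : ℍ) (z : ℂ) : ℂ → ℂ :=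
  Function.update (fun α => α * eisensteinKronecker τ α z) 0
    (limUnder (𝓝[≠] (0 : ℂ)) (fun α => α * eisensteinKronecker τ α z))

/-- `f_τ^{(n)}(z)`: the coefficient of `α^{n-1}` in the Laurent expansion
`F_τ(α, z) = ∑_{n ≥ 0} f_τ^{(n)}(z) α^{n-1}` at `α = 0`, that is, the `n`-th Taylor
coefficient of `α F_τ(α, z)` at `α = 0`. -/
def kroneckerCoeff (τ : ℍ) (n : ℕ) (z : ℂ) : ℂ :=
  iteratedDeriv n (alphaEisensteinKronecker τ z) 0 / (n.factorial : ℂ)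

/-- The iterated integral
`∫_{a < z_1 < ⋯ < z_r < b} g_{k_1}(z_1) dz_1 ⋯ g_{k_r}(z_r) dz_r` for an index
`[k_1, …, k_r]` (used with `a ≤ b`); it is `1` for the empty index. -/
def iterInt (g : ℕ → ℝ → ℂ) : List ℕ → ℝ → ℝ → ℂ
  | [], _, _ => 1
  | k :: ks, a, b => ∫ t in a..b, g k t * iterInt g ks t b

/-- `f(ε) = ∑_{n=0}^N c_n (log(-2πiε))^n + O(ε^δ)` as `ε → 0+` for some `N`, some constants
`c_n` and some `δ > 0`, with `c_0 = c`. The branch of the logarithm is the principal one, so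
`log(-i) = -πi/2`. -/
def HasRegValue (f : ℝ → ℂ) (c : ℂ) : Prop :=
  ∃ (P : Polynomial ℂ) (δ : ℝ), 0 < δ ∧ P.coeff 0 = c ∧
    (fun ε : ℝ => f ε - P.eval (Complex.log (-2 * Real.pi * Complex.I * ε)))
      =O[𝓝[>] (0 : ℝ)] (fun ε : ℝ => ε ^ δ)

/-- The regularized value at `ε → 0`. -/
def regValue (f : ℝ → ℂ) : ℂ := Classical.epsilon (HasRegValue f)

/-- `∫_{ε < z_1 < ⋯ < z_r < 1-ε} f_τ^{(k_1)}(z_1) dz_1 ⋯ f_τ^{(k_r)}(z_r) dz_r`. -/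
def truncatedIntegral (τ : ℍ) (k : List ℕ) (ε : ℝ) : ℂ :=
  iterInt (fun n t => kroneckerCoeff τ n (t : ℂ)) k ε (1 - ε)

/-- The regularized elliptic multiple zeta value `I^A(k_1, …, k_r; τ)`, as a function of `τ`. -/
def eMZV (k : List ℕ) (τ : ℍ) : ℂ := regValue (truncatedIntegral τ k)

/-- An index `(k_1, …, k_r)` is admissible if `k_1 ≠ 1` and `k_r ≠ 1`
(the empty index is admissible). -/
def Admissible (k : List ℕ) : Prop := k.head? ≠ some 1 ∧ k.getLast? ≠ some 1

/-- The `ℚ`-span of the values `I(k)`, over all indices `k`. -/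
def spanAll {A : Type*} [CommRing A] [Algebra ℚ A] (I : List ℕ → A) : Submodule ℚ A :=
  Submodule.span ℚ {x | ∃ k : List ℕ, I k = x}

/-- The `ℚ`-span of the values `I(k)`, over all admissible indices `k`. -/
def spanAdm {A : Type*} [CommRing A] [Algebra ℚ A] (I : List ℕ → A) : Submodule ℚ A :=
  Submodule.span ℚ {x | ∃ k : List ℕ, Admissible k ∧ I k = x}

/-- The set of the values `I(k)`, over all indices `k` with entries in `{0, 1}`. -/
def zeroOneValues {A : Type*} (I : List ℕ → A) : Set A :=
  {x | ∃ k : List ℕ, (∀ i ∈ k, i = 0 ∨ i = 1) ∧ I k = x}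

/-- The shuffle product of two words, as the list (with multiplicities) of its terms:
`a v ⧢ b w = a (v ⧢ b w) + b (a v ⧢ w)`, and the empty word is the unit. -/
def shuffle : List ℕ → List ℕ → List (List ℕ)
  | [], w => [w]
  | a :: v, [] => [a :: v]
  | a :: v, b :: w =>
    (shuffle v (b :: w)).map (fun u => a :: u) ++ (shuffle (a :: v) w).map (fun u => b :: u)
  termination_by v w => v.length + w.length

/-- The regularized value is unique. -/
theorem HasRegValue.unique {f : ℝ → ℂ} {c d : ℂ} (hc : HasRegValue f c)
    (hd : HasRegValue f d) : c = d := by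
  obtain ⟨P, δ, hδ, rfl, hP⟩ := hc
  obtain ⟨Q, η, hη, rfl, hQ⟩ := hd
  have h0 : ∀ s : ℝ, 0 < s → Tendsto (fun ε : ℝ => ε ^ s) (𝓝[>] (0 : ℝ)) (𝓝 0) := by
    intro s hs
    have h := (Real.continuousAt_rpow_const 0 s (Or.inr hs.le)).tendsto
    rw [Real.zero_rpow hs.ne'] at h
    exact h.mono_left nhdsWithin_le_nhds
  have hlim : Tendsto (fun ε : ℝ => (P - Q).eval
      (Complex.log (-2 * Real.pi * Complex.I * ε))) (𝓝[>] (0 : ℝ)) (𝓝 0) := by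
    have h := (hQ.trans_tendsto (h0 η hη)).sub (hP.trans_tendsto (h0 δ hδ))
    rw [sub_zero] at h
    refine h.congr fun ε => ?_
    rw [Polynomial.eval_sub]
    ring
  have hL : Tendsto (fun ε : ℝ => ‖Complex.log (-2 * Real.pi * Complex.I * ε)‖)
      (𝓝[>] (0 : ℝ)) atTop := by
    have h1 : Tendsto (fun ε : ℝ => 2 * Real.pi * ε) (𝓝[>] (0 : ℝ)) (𝓝[>] 0) := by
      refine tendsto_nhdsWithin_iff.2 ⟨?_, ?_⟩
      · have : Continuous fun ε : ℝ => 2 * Real.pi * ε := by fun_prop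
        simpa using (this.tendsto 0).mono_left nhdsWithin_le_nhds
      · filter_upwards [self_mem_nhdsWithin] with ε hε
        have : 0 < ε := hε
        exact Set.mem_Ioi.2 (by positivity)
    have h2 := tendsto_abs_atBot_atTop.comp (Real.tendsto_log_nhdsGT_zero.comp h1)
    refine tendsto_atTop_mono' _ ?_ h2
    filter_upwards [self_mem_nhdsWithin] with ε hε
    have hε' : 0 < ε := hε
    have h3 := Complex.abs_re_le_norm (Complex.log (-2 * Real.pi * Complex.I * ε))
    rw [Complex.log_re] at h3
    have h4 : ‖(-2 * Real.pi * Complex.I * ε : ℂ)‖ = 2 * Real.pi * ε := by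
      simp [abs_of_pos hε', abs_of_pos Real.pi_pos]
    rw [h4] at h3
    exact h3
  have hdeg : ¬ 0 < (P - Q).degree := by
    intro hpos
    have h := Polynomial.tendsto_norm_atTop (P - Q) hpos hL
    exact not_tendsto_nhds_of_tendsto_atTop h _ hlim.norm
  have hC := Polynomial.eq_C_of_degree_le_zero (not_lt.1 hdeg)
  rw [hC] at hlim
  simp only [Polynomial.eval_C] at hlim
  have := tendsto_nhds_unique hlim tendsto_const_nhds
  rw [Polynomial.coeff_sub] at this
  exact (sub_eq_zero.1 this.symm)

end EllipticMZV

end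

/-!
The integrands `f^{(k)}` have at most simple poles at the two ends of `[0, 1]` and no others on that
interval; this gives the asymptotic expansions. The rest of the theorem holds for any values that
multiply by the shuffle product and are `1` at the empty index and at the index `(0)`.

*Poles.* Write `f^{(k)} = N_k / θ` with `N_k` entire (`kroneckerCoeff_eq`,
`differentiable_kroneckerNumerator`). The zeros of `θ` on the real line are controlled by the
inequality `|θ(x)| ≥ C |1 - e^{-2πix}|` (`exists_le_norm_theta`), which shows both that `θ` does not
vanish on `(0, 1)` and that `θ'(0) ≠ 0`. It comes from the finite Jacobi triple product
(`finite_triple_product`), a case of the `q`-binomial theorem: apart from their factor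
`1 - w⁻¹` the finite products are bounded below uniformly on the unit circle, and the finite sums
converge to a nonzero multiple of the theta series by dominated convergence.

*Expansions.* Integrating `c dt/t` against a polynomial in `log(-2πit)` gives again such a
polynomial, and errors `O(t^{η-1})` integrate to a constant plus `O(t^η)`; so iterated integrals
from `x` to `1/2` have expansions as `x → 0`. The substitution `t ↦ 1 - t` treats the other end, and
the composition of paths joins the two halves (`exists_hasRegValue_iterInt`). Expansions multiply,
and the regularized value is multiplicative, so the shuffle product formula for iterated integrals
passes to the regularized values (`eMZV_mul_eMZV`).

*Generators.* Let `u` be a nonempty admissible index. Since `I(0) = 1`, the value `I(1^n u)` is the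
sum of the values at the terms of `0 ⧢ 1^n u`. If the `0` stands in front of a letter `1` of `1^n`,
the term has fewer leading letters `1`; the remaining terms are those of `1^n (0 ⧢ u)`. They are
also the terms of `1^n 0 ⧢ u` in which the first letter of `u` follows all of `1^n`, and the other
terms of this product again have fewer leading letters `1`. As `1^n 0` is an index in `{0, 1}`,
induction on `n` expresses `I(1^n u)` through admissible values and values with index in `{0, 1}`
(`value_replicate_append_mem`). Trailing letters `1` are removed by the usual shuffle
regularization, which uses the products `1 ⧢ v 1^m` (`value_mem`). No property of theta functions
beyond `f^{(0)} = 1` enters here.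
-/

noncomputable section

namespace EllipticMZV

open Filter Topology Asymptotics

/-! ### The shuffle algebra of indices -/

theorem shuffle_nil_left (w : List ℕ) : shuffle [] w = [w] := by rw [shuffle]

theorem shuffle_nil_right (w : List ℕ) : shuffle w [] = [w] := by
  cases w <;> rw [shuffle]

theorem shuffle_cons_cons (a b : ℕ) (v w : List ℕ) :
    shuffle (a :: v) (b :: w) =
      (shuffle v (b :: w)).map (fun u => a :: u) ++
        (shuffle (a :: v) w).map (fun u => b :: u) := by
  rw [shuffle]

/-- The first and the last letter of a term of `v ⧢ w` come from one of the two factors. -/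
theorem head?_getLast?_of_mem_shuffle {v w m : List ℕ} (hm : m ∈ shuffle v w) :
    (m.head? = v.head? ∨ m.head? = w.head?) ∧
      (m.getLast? = v.getLast? ∨ m.getLast? = w.getLast?) := by
  induction v, w using shuffle.induct generalizing m with
  | case1 w => simp_all [shuffle_nil_left]
  | case2 a v => simp_all [shuffle_nil_right]
  | case3 a v b w ih₁ ih₂ =>
    rw [shuffle_cons_cons, List.mem_append, List.mem_map, List.mem_map] at hm
    -- A letter in front of `u` changes the last letter only if `u` is empty.
    have key : ∀ (c : ℕ) (u : List ℕ), (c :: u).getLast? = some (u.getLast?.getD c) := by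
      intro c u
      rw [List.getLast?_cons]
    rcases hm with ⟨u, hu, rfl⟩ | ⟨u, hu, rfl⟩
    · refine ⟨Or.inl rfl, ?_⟩
      have := (ih₁ hu).2
      simp only [key] at this ⊢
      rcases this with h | h <;> simp [h]
    · refine ⟨Or.inr rfl, ?_⟩
      have := (ih₂ hu).2
      simp only [key] at this ⊢
      rcases this with h | h <;> simp [h]

theorem Admissible.of_mem_shuffle {v w m : List ℕ} (hv : Admissible v) (hw : Admissible w)
    (hm : m ∈ shuffle v w) : Admissible m := by
  obtain ⟨h₁, h₂⟩ := head?_getLast?_of_mem_shuffle hm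
  refine ⟨?_, ?_⟩
  · rcases h₁ with h | h <;> rw [h]
    exacts [hv.1, hw.1]
  · rcases h₂ with h | h <;> rw [h]
    exacts [hv.2, hw.2]

section Algebra

variable {A : Type*} [CommRing A]

theorem sum_map_mem {S : Type*} [SetLike S A] [AddSubmonoidClass S A] {R : S}
    (f : List ℕ → A) {L : List (List ℕ)} (h : ∀ m ∈ L, f m ∈ R) : (L.map f).sum ∈ R :=
  list_sum_mem fun x hx => by
    obtain ⟨m, hm, rfl⟩ := List.mem_map.1 hx
    exact h m hm

/-- Inserting the letter `1` into `v k 1^m`: the `m + 1` insertions behind `k` all give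
`v k 1^{m+1}`. -/
theorem sum_shuffle_one_append (f : List ℕ → A) (k m : ℕ) (v : List ℕ) :
    ((shuffle [1] (v ++ k :: List.replicate m 1)).map f).sum =
      ((shuffle [1] v).map (fun x => f (x ++ k :: List.replicate m 1))).sum +
        (m + 1) * f (v ++ k :: List.replicate (m + 1) 1) := by
  induction v generalizing f with
  | nil =>
    have h : ∀ (m : ℕ) (f : List ℕ → A),
        ((shuffle [1] (List.replicate m 1)).map f).sum =
          (m + 1) * f (List.replicate (m + 1) 1) := by
      intro m
      induction m with
      | zero => intro f; simp [shuffle_nil_right]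
      | succ m ih =>
        intro f
        rw [List.replicate_succ, shuffle_cons_cons, shuffle_nil_left]
        simp only [List.map_append, List.sum_append, List.map_map, List.map_cons, List.map_nil,
          List.sum_cons, List.sum_nil]
        rw [ih]
        simp only [Function.comp, List.replicate_succ]
        push_cast
        ring
    rw [List.nil_append, shuffle_cons_cons, shuffle_nil_left, shuffle_nil_right]
    simp only [List.map_append, List.sum_append, List.map_map, List.map_cons, List.map_nil,
          List.sum_cons, List.sum_nil]
    rw [h]
    simp [Function.comp]
  | cons a v ih =>
    rw [List.cons_append, shuffle_cons_cons, shuffle_cons_cons, shuffle_nil_left,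
      shuffle_nil_left]
    simp only [List.map_append, List.sum_append, List.map_map, List.map_cons, List.map_nil,
          List.sum_cons, List.sum_nil]
    rw [ih]
    simp [Function.comp_def, add_assoc]

/-- Inserting the letter `0` into `1^n u`: if the insertions in front of one of the `n` letters
`1` contribute elements of `R`, only the insertions into `u` matter modulo `R`. -/
theorem sum_shuffle_zero_sub_mem {S : Type*} [SetLike S A] [AddSubmonoidClass S A] {R : S}
    (f : List ℕ → A) (u : List ℕ) (n : ℕ)
    (h : ∀ i j, i + j + 1 = n →
      f (List.replicate i 1 ++ 0 :: (List.replicate (j + 1) 1 ++ u)) ∈ R) :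
    ∃ r ∈ R, ((shuffle [0] (List.replicate n 1 ++ u)).map f).sum =
      ((shuffle [0] u).map (fun x => f (List.replicate n 1 ++ x))).sum + r := by
  induction n generalizing f with
  | zero => exact ⟨0, zero_mem R, by simp⟩
  | succ n ih =>
    obtain ⟨r, hr, e⟩ := ih (fun x => f (1 :: x)) fun i j hij => by
      have := h (i + 1) j (by omega)
      simpa [List.replicate_succ] using this
    refine ⟨f (0 :: (List.replicate (n + 1) 1 ++ u)) + r,
      add_mem (by simpa using h 0 n (by omega)) hr, ?_⟩
    rw [List.replicate_succ, List.cons_append, shuffle_cons_cons, shuffle_nil_left]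
    simp only [List.map_append, List.sum_append, List.map_map, List.map_cons, List.map_nil,
          List.sum_cons, List.sum_nil]
    have : (f ∘ fun u => 1 :: u) = fun x => f (1 :: x) := rfl
    rw [this, e]
    simp only [List.cons_append]
    ring

/-- Shuffling `1^n 0` with `k u`: if the terms in which `k` stands in front of one of the `n`
letters `1` contribute elements of `R`, only the terms `1^n (0 ⧢ k u)` matter modulo `R`. -/
theorem sum_shuffle_replicate_sub_mem {S : Type*} [SetLike S A] [AddSubmonoidClass S A] {R : S}
    (f : List ℕ → A) (k : ℕ) (u : List ℕ) (n : ℕ)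
    (h : ∀ i j, i + j + 1 = n → ∀ x ∈ shuffle (List.replicate (j + 1) 1 ++ [0]) u,
      f (List.replicate i 1 ++ k :: x) ∈ R) :
    ∃ r ∈ R, ((shuffle (List.replicate n 1 ++ [0]) (k :: u)).map f).sum =
      ((shuffle [0] (k :: u)).map (fun x => f (List.replicate n 1 ++ x))).sum + r := by
  induction n generalizing f with
  | zero => exact ⟨0, zero_mem R, by simp⟩
  | succ n ih =>
    obtain ⟨r, hr, e⟩ := ih (fun x => f (1 :: x)) fun i j hij x hx => by
      have := h (i + 1) j (by omega) x hx
      simpa [List.replicate_succ] using this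
    refine ⟨((shuffle (List.replicate (n + 1) 1 ++ [0]) u).map (fun x => f (k :: x))).sum + r,
      add_mem (sum_map_mem _ fun x hx => by simpa using h 0 n (by omega) x hx) hr, ?_⟩
    rw [List.replicate_succ, List.cons_append, shuffle_cons_cons]
    simp only [List.map_append, List.sum_append, List.map_map]
    have : (f ∘ fun u => 1 :: u) = fun x => f (1 :: x) := rfl
    rw [this, e]
    simp only [List.cons_append, Function.comp_def]
    ring

variable [Algebra ℚ A] {I : List ℕ → A}

/-- Leading letters `1` can be removed: since `I [0] = 1`, the value at `1^n u` is the sum of the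
values at the terms of `0 ⧢ 1^n u`, and up to words with fewer leading letters `1` these are the
terms of the product `1^n 0 ⧢ u`, whose first factor has its letters in `{0, 1}`. -/
theorem value_replicate_append_mem (h0 : I [0] = 1)
    (hI : ∀ k l, I k * I l = ((shuffle k l).map I).sum) {R : Subalgebra ℚ A}
    (hadm : ∀ k, Admissible k → I k ∈ R) (hzo : ∀ k : List ℕ, (∀ i ∈ k, i = 0 ∨ i = 1) → I k ∈ R)
    (n : ℕ) (u : List ℕ) (hu : Admissible u) (hne : u ≠ []) :
    I (List.replicate n 1 ++ u) ∈ R := by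
  induction n using Nat.strong_induction_on generalizing u with
  | _ n ih =>
    obtain ⟨k, u, rfl⟩ := List.exists_cons_of_ne_nil hne
    obtain ⟨r, hr, e⟩ := sum_shuffle_zero_sub_mem (R := R) I (k :: u) n fun i j hij =>
      ih i (by omega) _ ⟨by simp, by
        have := hu.2
        rwa [← List.cons_append, List.getLast?_append_of_ne_nil _ (by simp)]⟩ (by simp)
    obtain ⟨s, hs, e'⟩ := sum_shuffle_replicate_sub_mem (R := R) I k u n fun i j hij x hx =>
      ih i (by omega) _ ⟨by simpa using hu.1, by
        have hmem : k :: x ∈ shuffle (List.replicate (j + 1) 1 ++ [0]) (k :: u) := by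
          rw [List.replicate_succ, List.cons_append, shuffle_cons_cons, List.mem_append]
          exact Or.inr (List.mem_map.2 ⟨x, hx, rfl⟩)
        rcases (head?_getLast?_of_mem_shuffle hmem).2 with h | h
        · rw [h]; simp
        · rw [h]; exact hu.2⟩ (by simp)
    rw [← hI, h0, one_mul] at e
    rw [← hI] at e'
    rw [e, ← sub_eq_of_eq_add e']
    refine R.add_mem (R.sub_mem (R.mul_mem (hzo _ ?_) (hadm _ hu)) hs) hr
    intro i hi
    simp only [List.mem_append, List.mem_replicate, List.mem_singleton] at hi
    omega

/-- Every value is a polynomial in admissible values and values with index in `{0, 1}`. The letters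
`1` at the end of an index are removed by shuffle regularization, those at the beginning by
`value_replicate_append_mem`. -/
theorem value_mem (h0 : I [0] = 1)
    (hI : ∀ k l, I k * I l = ((shuffle k l).map I).sum) {R : Subalgebra ℚ A}
    (hadm : ∀ k, Admissible k → I k ∈ R) (hzo : ∀ k : List ℕ, (∀ i ∈ k, i = 0 ∨ i = 1) → I k ∈ R)
    (w : List ℕ) : I w ∈ R := by
  -- Trailing letters `1` are removed with the help of the products `1 ⧢ v k 1^m`.
  have step : ∀ m k v, k ≠ 1 → I (v ++ k :: List.replicate m 1) ∈ R := by
    intro m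
    induction m with
    | zero =>
      intro k v hk
      have : ∃ n u, Admissible u ∧ u ≠ [] ∧ v ++ [k] = List.replicate n 1 ++ u := by
        clear hadm hzo
        induction v with
        | nil => exact ⟨0, [k], ⟨by simpa using hk, by simpa using hk⟩, by simp, by simp⟩
        | cons a v ih =>
          by_cases ha : a = 1
          · obtain ⟨n, u, h₁, h₂, h₃⟩ := ih
            exact ⟨n + 1, u, h₁, h₂, by simp [List.replicate_succ, h₃, ha]⟩
          · exact ⟨0, a :: v ++ [k], ⟨by simpa using ha, by
              rw [List.getLast?_append_of_ne_nil _ (by simp)]; simpa using hk⟩, by simp, by simp⟩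
      obtain ⟨n, u, h₁, h₂, h₃⟩ := this
      rw [List.replicate_zero, h₃]
      exact value_replicate_append_mem h0 hI hadm hzo n u h₁ h₂
    | succ m ih =>
      intro k v hk
      have e := sum_shuffle_one_append I k m v
      rw [← hI] at e
      have hmem : ((m : A) + 1) * I (v ++ k :: List.replicate (m + 1) 1) ∈ R := by
        rw [← sub_eq_of_eq_add' e]
        exact R.sub_mem (R.mul_mem (hzo _ (by simp)) (ih k v hk))
          (sum_map_mem _ fun x _ => ih k x hk)
      have h := R.smul_mem hmem ((m : ℚ) + 1)⁻¹
      have hm : ((m : ℚ) + 1) ≠ 0 := by positivity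
      have hc : ((m : A) + 1) = algebraMap ℚ A ((m : ℚ) + 1) := by simp
      rwa [hc, ← Algebra.smul_def, smul_smul, inv_mul_cancel₀ hm, one_smul] at h
  have : (∃ m, w = List.replicate m 1) ∨ ∃ m k v, k ≠ 1 ∧ w = v ++ k :: List.replicate m 1 := by
    induction w with
    | nil => exact Or.inl ⟨0, rfl⟩
    | cons a w ih =>
      rcases ih with ⟨m, rfl⟩ | ⟨m, k, v, hk, rfl⟩
      · by_cases ha : a = 1
        · exact Or.inl ⟨m + 1, by rw [ha, List.replicate_succ]⟩
        · exact Or.inr ⟨m, a, [], ha, rfl⟩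
      · exact Or.inr ⟨m, k, a :: v, hk, rfl⟩
  rcases this with ⟨m, rfl⟩ | ⟨m, k, v, hk, rfl⟩
  · exact hzo _ fun i hi => Or.inr (List.eq_of_mem_replicate hi)
  · exact step m k v hk

/-- For any family of values that multiplies by the shuffle product and takes the value `1` at the
empty index and at the index `0`, the two spans are algebras, and the values with admissible index
or with index in `{0, 1}` generate all values. -/
theorem exists_subalgebra_eq_adjoin (hnil : I [] = 1) (h0 : I [0] = 1)
    (hI : ∀ k l, I k * I l = ((shuffle k l).map I).sum) :
    ∃ E Eadm : Subalgebra ℚ A,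
      Subalgebra.toSubmodule E = spanAll I ∧
      Subalgebra.toSubmodule Eadm = spanAdm I ∧
      E = (Algebra.adjoin Eadm (zeroOneValues I)).restrictScalars ℚ := by
  have hall : ∀ k, I k ∈ spanAll I := fun k => Submodule.subset_span ⟨k, rfl⟩
  have hadm : ∀ k, Admissible k → I k ∈ spanAdm I :=
    fun k hk => Submodule.subset_span ⟨k, hk, rfl⟩
  have mulAll : ∀ x y, x ∈ spanAll I → y ∈ spanAll I → x * y ∈ spanAll I := by
    intro x y hx hy
    induction hx, hy using Submodule.span_induction₂ with
    | mem_mem x y hx hy =>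
      obtain ⟨k, rfl⟩ := hx
      obtain ⟨l, rfl⟩ := hy
      rw [hI]
      exact sum_map_mem _ fun m _ => hall m
    | zero_left y hy => simp
    | zero_right x hx => simp
    | add_left x y z hx hy hz h₁ h₂ => rw [add_mul]; exact add_mem h₁ h₂
    | add_right x y z hx hy hz h₁ h₂ => rw [mul_add]; exact add_mem h₁ h₂
    | smul_left r x y hx hy h => rw [smul_mul_assoc]; exact Submodule.smul_mem _ _ h
    | smul_right r x y hx hy h => rw [mul_smul_comm]; exact Submodule.smul_mem _ _ h
  have mulAdm : ∀ x y, x ∈ spanAdm I → y ∈ spanAdm I → x * y ∈ spanAdm I := by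
    intro x y hx hy
    induction hx, hy using Submodule.span_induction₂ with
    | mem_mem x y hx hy =>
      obtain ⟨k, hk, rfl⟩ := hx
      obtain ⟨l, hl, rfl⟩ := hy
      rw [hI]
      exact sum_map_mem _ fun m hm => hadm m (hk.of_mem_shuffle hl hm)
    | zero_left y hy => simp
    | zero_right x hx => simp
    | add_left x y z hx hy hz h₁ h₂ => rw [add_mul]; exact add_mem h₁ h₂
    | add_right x y z hx hy hz h₁ h₂ => rw [mul_add]; exact add_mem h₁ h₂
    | smul_left r x y hx hy h => rw [smul_mul_assoc]; exact Submodule.smul_mem _ _ h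
    | smul_right r x y hx hy h => rw [mul_smul_comm]; exact Submodule.smul_mem _ _ h
  obtain ⟨E, hE⟩ : ∃ E : Subalgebra ℚ A, Subalgebra.toSubmodule E = spanAll I :=
    ⟨(spanAll I).toSubalgebra (hnil ▸ hall []) mulAll, Submodule.toSubalgebra_toSubmodule _ _ _⟩
  obtain ⟨Eadm, hEadm⟩ : ∃ E : Subalgebra ℚ A, Subalgebra.toSubmodule E = spanAdm I :=
    ⟨(spanAdm I).toSubalgebra (hnil ▸ hadm [] ⟨by simp, by simp⟩) mulAdm,
      Submodule.toSubalgebra_toSubmodule _ _ _⟩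
  have memE : ∀ x, x ∈ E ↔ x ∈ spanAll I := fun x => by
    rw [← hE, Subalgebra.mem_toSubmodule]
  have memEadm : ∀ x, x ∈ Eadm ↔ x ∈ spanAdm I := fun x => by
    rw [← hEadm, Subalgebra.mem_toSubmodule]
  refine ⟨E, Eadm, hE, hEadm, le_antisymm ?_ ?_⟩
  · rw [← Subalgebra.toSubmodule.le_iff_le, hE]
    refine Submodule.span_le.2 ?_
    rintro _ ⟨k, rfl⟩
    refine value_mem h0 hI (fun k hk => ?_) (fun k hk => ?_) k
    · rw [Subalgebra.mem_restrictScalars]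
      exact (Algebra.adjoin Eadm (zeroOneValues I)).algebraMap_mem
        ⟨I k, (memEadm _).2 (hadm k hk)⟩
    · rw [Subalgebra.mem_restrictScalars]
      exact Algebra.subset_adjoin ⟨k, hk, rfl⟩
  · intro x hx
    rw [Subalgebra.mem_restrictScalars] at hx
    induction hx using Algebra.adjoin_induction with
    | mem x hx =>
      obtain ⟨k, -, rfl⟩ := hx
      exact (memE _).2 (hall k)
    | algebraMap r =>
      have hr : (r : A) ∈ spanAdm I := (memEadm _).1 r.2
      refine (memE _).2 ?_
      exact Submodule.span_mono (by rintro _ ⟨k, -, rfl⟩; exact ⟨k, rfl⟩) hr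
    | add x y hx hy h₁ h₂ => exact E.add_mem h₁ h₂
    | mul x y hx hy h₁ h₂ => exact E.mul_mem h₁ h₂

end Algebra

/-! ### Asymptotic expansions in powers of the logarithm -/

/-- The logarithm `log(-2πiε)` in whose powers the truncated integrals are expanded. -/
def regLog (ε : ℝ) : ℂ := Complex.log (-2 * Real.pi * Complex.I * ε)

theorem regLog_eq {ε : ℝ} (hε : 0 < ε) : regLog ε = (Real.log ε : ℂ) + regLog 1 := by
  have h : (-2 * Real.pi * Complex.I : ℂ) ≠ 0 := by
    simp [Real.pi_ne_zero]
  rw [regLog, regLog, mul_comm, Complex.log_ofReal_mul hε h, Complex.ofReal_one, mul_one]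

theorem hasDerivAt_regLog {t : ℝ} (ht : 0 < t) : HasDerivAt regLog ((t : ℂ)⁻¹) t := by
  have h := ((Real.hasDerivAt_log ht.ne').ofReal_comp).add_const (regLog 1)
  rw [Complex.ofReal_inv] at h
  refine h.congr_of_eventuallyEq ?_
  filter_upwards [lt_mem_nhds ht] with x hx using regLog_eq hx

theorem isBigO_rpow_rpow {a b : ℝ} (h : a ≤ b) :
    (fun ε : ℝ => ε ^ b) =O[𝓝[>] (0 : ℝ)] (fun ε : ℝ => ε ^ a) := by
  refine IsBigO.of_bound 1 ?_
  filter_upwards [Ioo_mem_nhdsGT (zero_lt_one (α := ℝ))] with ε hε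
  rw [Real.norm_of_nonneg (Real.rpow_nonneg hε.1.le _),
    Real.norm_of_nonneg (Real.rpow_nonneg hε.1.le _), one_mul]
  exact Real.rpow_le_rpow_of_exponent_ge hε.1 hε.2.le h

theorem IsBigO.mul_rpow {f g : ℝ → ℂ} {a b : ℝ}
    (hf : f =O[𝓝[>] (0 : ℝ)] (fun ε : ℝ => ε ^ a))
    (hg : g =O[𝓝[>] (0 : ℝ)] (fun ε : ℝ => ε ^ b)) :
    (fun ε => f ε * g ε) =O[𝓝[>] (0 : ℝ)] (fun ε : ℝ => ε ^ (a + b)) := by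
  refine (hf.mul hg).congr' EventuallyEq.rfl ?_
  filter_upwards [self_mem_nhdsWithin] with ε hε
  exact (Real.rpow_add hε a b).symm

theorem isBigO_const_rpow (c : ℂ) {a : ℝ} (ha : a ≤ 0) :
    (fun _ : ℝ => c) =O[𝓝[>] (0 : ℝ)] (fun ε : ℝ => ε ^ a) := by
  have h := isBigO_rpow_rpow ha
  simp only [Real.rpow_zero] at h
  exact (isBigO_const_const c one_ne_zero _).trans h

theorem isBigO_regLog {s : ℝ} (hs : 0 < s) :
    regLog =O[𝓝[>] (0 : ℝ)] (fun ε : ℝ => ε ^ (-s)) := by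
  have h₁ : (fun ε : ℝ => (Real.log ε : ℂ)) =O[𝓝[>] (0 : ℝ)] (fun ε : ℝ => ε ^ (-s)) := by
    refine IsBigO.of_norm_left ?_
    simp only [Complex.norm_real]
    exact (isLittleO_log_rpow_nhdsGT_zero (neg_lt_zero.2 hs)).isBigO.norm_left
  refine (h₁.add (isBigO_const_rpow (regLog 1) (neg_lt_zero.2 hs).le)).congr' ?_ EventuallyEq.rfl
  filter_upwards [self_mem_nhdsWithin] with ε hε
  exact (regLog_eq hε).symm

theorem isBigO_eval_regLog (P : Polynomial ℂ) {s : ℝ} (hs : 0 < s) :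
    (fun ε => P.eval (regLog ε)) =O[𝓝[>] (0 : ℝ)] (fun ε : ℝ => ε ^ (-s)) := by
  induction P using Polynomial.induction_on generalizing s with
  | C a => simpa using isBigO_const_rpow a (neg_lt_zero.2 hs).le
  | add P Q hP hQ => simpa using (hP hs).add (hQ hs)
  | monomial n a ih =>
    have h := IsBigO.mul_rpow (ih (half_pos hs)) (isBigO_regLog (half_pos hs))
    rw [← neg_add, add_halves] at h
    refine h.congr_left fun ε => ?_
    simp [pow_succ, mul_assoc]

theorem HasRegValue.isBigO {f : ℝ → ℂ} {c : ℂ} (h : HasRegValue f c) {s : ℝ} (hs : 0 < s) :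
    f =O[𝓝[>] (0 : ℝ)] (fun ε : ℝ => ε ^ (-s)) := by
  obtain ⟨P, δ, hδ, -, hP⟩ := h
  have h := (hP.trans (isBigO_rpow_rpow (by linarith : -s ≤ δ))).add (isBigO_eval_regLog P hs)
  exact h.congr_left fun ε => by simp [regLog]

theorem hasRegValue_const (c : ℂ) : HasRegValue (fun _ => c) c :=
  ⟨Polynomial.C c, 1, one_pos, by simp, by simpa using isBigO_zero _ _⟩

theorem HasRegValue.congr {f g : ℝ → ℂ} {c : ℂ} (h : HasRegValue f c)
    (hfg : f =ᶠ[𝓝[>] (0 : ℝ)] g) : HasRegValue g c := by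
  obtain ⟨P, δ, hδ, hc, hP⟩ := h
  refine ⟨P, δ, hδ, hc, hP.congr' ?_ EventuallyEq.rfl⟩
  filter_upwards [hfg] with ε hε
  rw [hε]

theorem HasRegValue.add {f g : ℝ → ℂ} {c d : ℂ} (hf : HasRegValue f c) (hg : HasRegValue g d) :
    HasRegValue (fun ε => f ε + g ε) (c + d) := by
  obtain ⟨P, δ, hδ, hc, hP⟩ := hf
  obtain ⟨Q, η, hη, hd, hQ⟩ := hg
  refine ⟨P + Q, min δ η, lt_min hδ hη, by simp [hc, hd], ?_⟩
  refine ((hP.trans (isBigO_rpow_rpow (min_le_left δ η))).add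
    (hQ.trans (isBigO_rpow_rpow (min_le_right δ η)))).congr_left fun ε => ?_
  rw [Polynomial.eval_add]
  ring

theorem HasRegValue.mul {f g : ℝ → ℂ} {c d : ℂ} (hf : HasRegValue f c) (hg : HasRegValue g d) :
    HasRegValue (fun ε => f ε * g ε) (c * d) := by
  obtain ⟨P, δ, hδ, hc, hP⟩ := id hf
  obtain ⟨Q, η, hη, hd, hQ⟩ := hg
  refine ⟨P * Q, min (δ / 2) (η / 2), lt_min (half_pos hδ) (half_pos hη),
    by simp [Polynomial.mul_coeff_zero, hc, hd], ?_⟩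
  have h₁ := IsBigO.mul_rpow hP (isBigO_eval_regLog Q (half_pos hδ))
  have h₂ := IsBigO.mul_rpow (hf.isBigO (half_pos hη)) hQ
  rw [show δ + -(δ / 2) = δ / 2 by ring] at h₁
  rw [show -(η / 2) + η = η / 2 by ring] at h₂
  refine ((h₁.trans (isBigO_rpow_rpow (min_le_left _ _))).add
    (h₂.trans (isBigO_rpow_rpow (min_le_right _ _)))).congr_left fun ε => ?_
  simp only [Polynomial.eval_mul, regLog]
  ring

theorem HasRegValue.const_mul {f : ℝ → ℂ} {c : ℂ} (a : ℂ) (hf : HasRegValue f c) :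
    HasRegValue (fun ε => a * f ε) (a * c) := (hasRegValue_const a).mul hf

theorem HasRegValue.list_sum {ι : Type*} {F : ι → ℝ → ℂ} {c : ι → ℂ} (L : List ι)
    (h : ∀ m ∈ L, HasRegValue (F m) (c m)) :
    HasRegValue (fun ε => (L.map fun m => F m ε).sum) (L.map c).sum := by
  induction L with
  | nil => simpa using hasRegValue_const 0
  | cons m L ih =>
    simpa using (h m (by simp)).add (ih fun m hm => h m (List.mem_cons_of_mem _ hm))

theorem exists_hasRegValue_finset_sum {ι : Type*} {F : ι → ℝ → ℂ} (s : Finset ι)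
    (h : ∀ i ∈ s, ∃ c, HasRegValue (F i) c) : ∃ c, HasRegValue (fun ε => ∑ i ∈ s, F i ε) c := by
  classical
  induction s using Finset.induction_on with
  | empty => exact ⟨0, by simpa using hasRegValue_const 0⟩
  | insert i s hi ih =>
    obtain ⟨c, hc⟩ := h i (Finset.mem_insert_self i s)
    obtain ⟨d, hd⟩ := ih fun j hj => h j (Finset.mem_insert_of_mem hj)
    exact ⟨c + d, by simpa [Finset.sum_insert hi] using hc.add hd⟩

theorem exists_derivative_eq (P : Polynomial ℂ) :
    ∃ Q : Polynomial ℂ, Polynomial.derivative Q = P := by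
  induction P using Polynomial.induction_on' with
  | add P Q hP hQ =>
    obtain ⟨P', rfl⟩ := hP
    obtain ⟨Q', rfl⟩ := hQ
    exact ⟨P' + Q', by simp⟩
  | monomial n a =>
    refine ⟨Polynomial.monomial (n + 1) (a / (n + 1)), ?_⟩
    have : (n + 1 : ℂ) ≠ 0 := by exact_mod_cast n.succ_ne_zero
    rw [Polynomial.derivative_monomial]
    simp [this]

/-- An integrand that is `O(t^{η-1})` at `0` for some `η > 0` contributes a constant and an error
term `O(x^η)` to the integral from `x`. -/
theorem isBigO_integral_of_isBigO {e : ℝ → ℂ} {η b : ℝ} (hη : 0 < η) (hb : 0 < b)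
    (hc : ContinuousOn e (Set.Ioc 0 b))
    (he : e =O[𝓝[>] (0 : ℝ)] (fun t : ℝ => t ^ (η - 1))) :
    (fun x => (∫ t in x..b, e t) - ∫ t in (0 : ℝ)..b, e t) =O[𝓝[>] (0 : ℝ)]
      (fun x : ℝ => x ^ η) := by
  obtain ⟨C, hC⟩ := he.bound
  obtain ⟨ρ, hρ, hρC⟩ := (mem_nhdsGT_iff_exists_Ioo_subset).1 hC
  have hρ0 : 0 < ρ := hρ
  have hη' : -1 < η - 1 := by linarith
  obtain ⟨σ, hσ, hσρ, hσb⟩ : ∃ σ, 0 < σ ∧ σ < ρ ∧ σ ≤ b :=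
    ⟨min (ρ / 2) b, lt_min (half_pos hρ0) hb, (min_le_left _ _).trans_lt (half_lt_self hρ0),
      min_le_right _ _⟩
  have hbound : ∀ t, 0 < t → t < ρ → ‖e t‖ ≤ C * t ^ (η - 1) := fun t h0 h1 => by
    have := hρC ⟨h0, h1⟩
    simpa [abs_of_nonneg (Real.rpow_nonneg h0.le _)] using this
  have hint : ∀ x, 0 ≤ x → x ≤ σ →
      IntervalIntegrable e MeasureTheory.volume 0 x := by
    intro x hx hxσ
    have h1 : IntervalIntegrable (fun t : ℝ => C * t ^ (η - 1)) MeasureTheory.volume 0 x :=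
      (intervalIntegral.intervalIntegrable_rpow' hη').const_mul C
    refine h1.mono_fun' ?_ ?_
    · rw [Set.uIoc_of_le hx]
      exact (hc.mono (Set.Ioc_subset_Ioc_right (hxσ.trans hσb))).aestronglyMeasurable
        measurableSet_Ioc
    · rw [Set.uIoc_of_le hx]
      refine (MeasureTheory.ae_restrict_iff' measurableSet_Ioc).2 (Eventually.of_forall ?_)
      exact fun t ht => hbound t ht.1 (ht.2.trans_lt (hxσ.trans_lt hσρ))
  have hint' : ∀ x, 0 < x → x ≤ b → IntervalIntegrable e MeasureTheory.volume x b := by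
    intro x hx hxb
    refine ContinuousOn.intervalIntegrable (hc.mono ?_)
    rw [Set.uIcc_of_le hxb]
    exact fun t ht => ⟨hx.trans_le ht.1, ht.2⟩
  refine IsBigO.of_bound (C / η) ?_
  filter_upwards [Ioo_mem_nhdsGT hσ] with x hx
  have hsplit := intervalIntegral.integral_add_adjacent_intervals (hint x hx.1.le hx.2.le)
    (hint' x hx.1 (hx.2.le.trans hσb))
  have hle : ‖∫ t in (0 : ℝ)..x, e t‖ ≤ ∫ t in (0 : ℝ)..x, C * t ^ (η - 1) := by
    refine intervalIntegral.norm_integral_le_of_norm_le hx.1.le (Eventually.of_forall ?_)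
      ((intervalIntegral.intervalIntegrable_rpow' hη').const_mul C)
    exact fun t ht => hbound t ht.1 (ht.2.trans_lt (hx.2.trans hσρ))
  rw [intervalIntegral.integral_const_mul, integral_rpow (Or.inl hη'), sub_add_cancel,
    Real.zero_rpow hη.ne', sub_zero] at hle
  rw [← hsplit, sub_add_cancel_right, norm_neg,
    Real.norm_of_nonneg (Real.rpow_nonneg hx.1.le _)]
  calc _ ≤ _ := hle
    _ = _ := by ring

/-- Integration against a form with at most a simple pole at `0` preserves the existence of an
expansion: the polar part `c dt/t` integrates a polynomial in `log(-2πit)` to a polynomial in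
`log(-2πit)`. -/
theorem exists_hasRegValue_integral {g f : ℝ → ℂ} {c : ℂ}
    (hg : ContinuousOn g (Set.Ioo 0 1)) (hf : ContinuousOn f (Set.Ioo 0 1))
    (hgc : (fun t : ℝ => g t - c / t) =O[𝓝[>] (0 : ℝ)] (fun _ => (1 : ℝ)))
    (h : ∃ d, HasRegValue f d) :
    ∃ d, HasRegValue (fun x => ∫ t in x..(1 / 2), g t * f t) d := by
  obtain ⟨d, hd⟩ := h
  obtain ⟨P, δ, hδ, -, hP⟩ := id hd
  obtain ⟨Q, hQ⟩ := exists_derivative_eq P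
  have hη : 0 < min δ (1 / 2) := lt_min hδ (by norm_num)
  set η := min δ (1 / 2) with hηdef
  have hinv : (fun t : ℝ => c / t) =O[𝓝[>] (0 : ℝ)] (fun t : ℝ => t ^ (-1 : ℝ)) := by
    refine IsBigO.of_bound ‖c‖ ?_
    filter_upwards [self_mem_nhdsWithin] with t ht
    have ht' : 0 < t := ht
    rw [Real.rpow_neg_one, norm_div, Complex.norm_real, norm_inv, div_eq_mul_inv]
  have hpole : ∀ t : ℝ, 0 < t →
      HasDerivAt (fun t => c * Q.eval (regLog t)) (c / t * P.eval (regLog t)) t := by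
    intro t ht
    have h := ((Q.hasDerivAt (regLog t)).comp t (hasDerivAt_regLog ht)).const_mul c
    rw [hQ] at h
    exact h.congr_deriv (by ring)
  have hcontP : ContinuousOn (fun t : ℝ => c / t * P.eval (regLog t)) (Set.Ioi 0) := by
    refine ContinuousOn.mul (continuousOn_const.div Complex.continuous_ofReal.continuousOn ?_) ?_
    · exact fun t ht => Complex.ofReal_ne_zero.2 (ne_of_gt ht)
    · exact fun t ht =>
        (P.continuous.continuousAt.comp (hasDerivAt_regLog ht).continuousAt).continuousWithinAt
  have hcontgf : ContinuousOn (fun t : ℝ => g t * f t) (Set.Ioc 0 (1 / 2)) :=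
    (hg.mul hf).mono fun t ht => ⟨ht.1, ht.2.trans_lt (by norm_num)⟩
  set e : ℝ → ℂ := fun t => g t * f t - c / t * P.eval (regLog t) with he
  have hce : ContinuousOn e (Set.Ioc 0 (1 / 2)) :=
    hcontgf.sub (hcontP.mono fun t ht => ht.1)
  have hO : e =O[𝓝[>] (0 : ℝ)] (fun t : ℝ => t ^ (η - 1)) := by
    have h1 : (fun t : ℝ => g t - c / t) =O[𝓝[>] (0 : ℝ)] (fun t : ℝ => t ^ (0 : ℝ)) := by
      simpa only [Real.rpow_zero] using hgc
    have h2 := (IsBigO.mul_rpow h1 (hd.isBigO (half_pos one_pos))).trans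
      (isBigO_rpow_rpow (a := η - 1) (by have := min_le_right δ (1 / 2); linarith))
    have h3 := (IsBigO.mul_rpow hinv hP).trans
      (isBigO_rpow_rpow (a := η - 1) (by have := min_le_left δ (1 / 2); linarith))
    refine (h2.add h3).congr_left fun t => ?_
    simp only [he, regLog]
    ring
  have hmain := isBigO_integral_of_isBigO hη (by norm_num : (0 : ℝ) < 1 / 2) hce hO
  refine ⟨_, Polynomial.C ((∫ t in (0 : ℝ)..(1 / 2), e t) + c * Q.eval (regLog (1 / 2)))
    - Polynomial.C c * Q, η, hη, rfl, hmain.congr' ?_ EventuallyEq.rfl⟩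
  filter_upwards [Ioo_mem_nhdsGT (by norm_num : (0 : ℝ) < 1 / 2)] with x hx
  have hsub : Set.uIcc x (1 / 2) ⊆ Set.Ioc 0 (1 / 2) := by
    rw [Set.uIcc_of_le hx.2.le]
    exact fun t ht => ⟨hx.1.trans_le ht.1, ht.2⟩
  have hi1 := (hce.mono hsub).intervalIntegrable (μ := MeasureTheory.volume)
  have hi2 := (hcontP.mono (hsub.trans fun t ht => ht.1)).intervalIntegrable
    (μ := MeasureTheory.volume)
  have hFTC := intervalIntegral.integral_eq_sub_of_hasDerivAt
    (fun t ht => hpole t (hsub ht).1) hi2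
  have hadd := intervalIntegral.integral_add hi1 hi2
  rw [hFTC] at hadd
  have hgf : (fun t : ℝ => e t + c / t * P.eval (regLog t)) = fun t => g t * f t := by
    funext t
    simp [he]
  rw [hgf] at hadd
  change _ = _ - Polynomial.eval (regLog x) _
  rw [hadd, Polynomial.eval_sub, Polynomial.eval_mul, Polynomial.eval_C, Polynomial.eval_C]
  ring

/-! ### Iterated integrals -/

section IterInt

variable {g : ℕ → ℝ → ℂ}

theorem hasDerivAt_integral_left_of_continuousOn {h : ℝ → ℂ}
    (hc : ContinuousOn h (Set.Ioo 0 1)) {a b : ℝ} (ha : a ∈ Set.Ioo (0 : ℝ) 1)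
    (hb : b ∈ Set.Ioo (0 : ℝ) 1) : HasDerivAt (fun x => ∫ t in x..b, h t) (-h a) a :=
  intervalIntegral.integral_hasDerivAt_left
    (hc.mono (Set.ordConnected_Ioo.uIcc_subset ha hb)).intervalIntegrable
    (hc.stronglyMeasurableAtFilter isOpen_Ioo a ha) (hc.continuousAt (isOpen_Ioo.mem_nhds ha))

theorem continuousOn_iterInt (hg : ∀ k, ContinuousOn (g k) (Set.Ioo 0 1)) {b : ℝ}
    (hb : b ∈ Set.Ioo (0 : ℝ) 1) (w : List ℕ) :
    ContinuousOn (fun a => iterInt g w a b) (Set.Ioo 0 1) := by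
  induction w with
  | nil => exact continuousOn_const
  | cons k w ih =>
    exact fun a ha => (hasDerivAt_integral_left_of_continuousOn ((hg k).mul ih) ha
      hb).continuousAt.continuousWithinAt

theorem hasDerivAt_iterInt_cons (hg : ∀ k, ContinuousOn (g k) (Set.Ioo 0 1)) {a b : ℝ}
    (ha : a ∈ Set.Ioo (0 : ℝ) 1) (hb : b ∈ Set.Ioo (0 : ℝ) 1) (k : ℕ) (w : List ℕ) :
    HasDerivAt (fun a => iterInt g (k :: w) a b) (-(g k a * iterInt g w a b)) a :=
  hasDerivAt_integral_left_of_continuousOn ((hg k).mul (continuousOn_iterInt hg hb w)) ha hb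

theorem intervalIntegrable_mul_iterInt (hg : ∀ k, ContinuousOn (g k) (Set.Ioo 0 1)) {a b c : ℝ}
    (ha : a ∈ Set.Ioo (0 : ℝ) 1) (hb : b ∈ Set.Ioo (0 : ℝ) 1) (hc : c ∈ Set.Ioo (0 : ℝ) 1)
    (k : ℕ) (w : List ℕ) :
    IntervalIntegrable (fun t => g k t * iterInt g w t c) MeasureTheory.volume a b :=
  (((hg k).mul (continuousOn_iterInt hg hc w)).mono
    (Set.ordConnected_Ioo.uIcc_subset ha hb)).intervalIntegrable

/-- Composition of paths. -/
theorem iterInt_eq_sum_take_drop (hg : ∀ k, ContinuousOn (g k) (Set.Ioo 0 1)) {a b c : ℝ}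
    (ha : a ∈ Set.Ioo (0 : ℝ) 1) (hb : b ∈ Set.Ioo (0 : ℝ) 1) (hc : c ∈ Set.Ioo (0 : ℝ) 1)
    (w : List ℕ) :
    iterInt g w a c =
      ∑ i ∈ Finset.range (w.length + 1), iterInt g (w.take i) a b * iterInt g (w.drop i) b c := by
  induction w generalizing a with
  | nil => simp [iterInt]
  | cons k w ih =>
    rw [Finset.sum_range_succ']
    simp only [List.length_cons, List.take_succ_cons, List.drop_succ_cons, List.take_zero,
      List.drop_zero, iterInt, one_mul]
    rw [← intervalIntegral.integral_add_adjacent_intervals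
      (intervalIntegrable_mul_iterInt hg ha hb hc k w)
      (intervalIntegrable_mul_iterInt hg hb hc hc k w)]
    congr 1
    have h1 : ∀ t ∈ Set.uIcc a b, g k t * iterInt g w t c =
        ∑ i ∈ Finset.range (w.length + 1),
          g k t * iterInt g (w.take i) t b * iterInt g (w.drop i) b c := by
      intro t ht
      rw [ih (Set.ordConnected_Ioo.uIcc_subset ha hb ht), Finset.mul_sum]
      exact Finset.sum_congr rfl fun i _ => by ring
    rw [intervalIntegral.integral_congr h1, intervalIntegral.integral_finsetSum]
    · simp only [intervalIntegral.integral_mul_const]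
    · exact fun i _ => (intervalIntegrable_mul_iterInt hg ha hb hb k _).mul_const _

/-- The shuffle product formula, by integration by parts. -/
theorem iterInt_mul_iterInt (hg : ∀ k, ContinuousOn (g k) (Set.Ioo 0 1)) {a b : ℝ}
    (ha : a ∈ Set.Ioo (0 : ℝ) 1) (hb : b ∈ Set.Ioo (0 : ℝ) 1) (v w : List ℕ) :
    iterInt g v a b * iterInt g w a b =
      ((shuffle v w).map fun m => iterInt g m a b).sum := by
  have hsum : ∀ (k : ℕ) (L : List (List ℕ)) {a : ℝ}, a ∈ Set.Ioo (0 : ℝ) 1 →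
      ∫ t in a..b, g k t * (L.map fun m => iterInt g m t b).sum =
        (L.map fun m => iterInt g (k :: m) a b).sum := by
    intro k L a ha
    have hint : ∀ L : List (List ℕ), IntervalIntegrable
        (fun t => g k t * (L.map fun m => iterInt g m t b).sum) MeasureTheory.volume a b := by
      intro L
      induction L with
      | nil => simp
      | cons m L ih =>
        simpa [mul_add] using (intervalIntegrable_mul_iterInt hg ha hb hb k m).add ih
    induction L with
    | nil => simp
    | cons m L ih =>
      simp only [List.map_cons, List.sum_cons, mul_add]
      rw [intervalIntegral.integral_add (intervalIntegrable_mul_iterInt hg ha hb hb k m) (hint L),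
        ih]
      rfl
  induction v, w using shuffle.induct generalizing a with
  | case1 w => simp [shuffle_nil_left, iterInt]
  | case2 k v => simp [shuffle_nil_right, iterInt]
  | case3 k v l w ih₁ ih₂ =>
    have hsub := Set.ordConnected_Ioo.uIcc_subset ha hb
    have hparts := intervalIntegral.integral_deriv_mul_eq_sub
      (fun t ht => hasDerivAt_iterInt_cons hg (hsub ht) hb k v)
      (fun t ht => hasDerivAt_iterInt_cons hg (hsub ht) hb l w)
      (intervalIntegrable_mul_iterInt hg ha hb hb k v).neg
      (intervalIntegrable_mul_iterInt hg ha hb hb l w).neg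
    have hbb : iterInt g (k :: v) b b = 0 := intervalIntegral.integral_same
    rw [hbb, zero_mul, zero_sub] at hparts
    have hint₁ : IntervalIntegrable (fun t => g k t * iterInt g v t b * iterInt g (l :: w) t b)
        MeasureTheory.volume a b :=
      ((((hg k).mul (continuousOn_iterInt hg hb v)).mul
        (continuousOn_iterInt hg hb (l :: w))).mono hsub).intervalIntegrable
    have hint₂ : IntervalIntegrable (fun t => g l t * iterInt g w t b * iterInt g (k :: v) t b)
        MeasureTheory.volume a b :=
      ((((hg l).mul (continuousOn_iterInt hg hb w)).mul
        (continuousOn_iterInt hg hb (k :: v))).mono hsub).intervalIntegrable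
    have h₁ : ∫ t in a..b, g k t * iterInt g v t b * iterInt g (l :: w) t b =
        ((shuffle v (l :: w)).map fun m => iterInt g (k :: m) a b).sum := by
      rw [← hsum k _ ha]
      refine intervalIntegral.integral_congr fun t ht => ?_
      rw [mul_assoc, ih₁ (hsub ht)]
    have h₂ : ∫ t in a..b, g l t * iterInt g w t b * iterInt g (k :: v) t b =
        ((shuffle (k :: v) w).map fun m => iterInt g (l :: m) a b).sum := by
      rw [← hsum l _ ha]
      refine intervalIntegral.integral_congr fun t ht => ?_
      rw [mul_assoc, mul_comm (iterInt g w t b), ih₂ (hsub ht)]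
    rw [shuffle_cons_cons, List.map_append, List.sum_append, List.map_map, List.map_map]
    simp only [Function.comp_def]
    rw [← h₁, ← h₂, ← intervalIntegral.integral_add hint₁ hint₂, ← neg_inj, ← hparts,
      ← intervalIntegral.integral_neg]
    exact intervalIntegral.integral_congr fun t _ => by ring

/-- The substitution `t ↦ 1 - t`, without reversal of the order of integration. -/
theorem iterInt_comp_one_sub (g : ℕ → ℝ → ℂ) (w : List ℕ) (a b : ℝ) :
    iterInt (fun k t => -g k (1 - t)) w a b = iterInt g w (1 - a) (1 - b) := by
  induction w generalizing a with
  | nil => rfl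
  | cons k w ih =>
    simp only [iterInt, ih, neg_mul, intervalIntegral.integral_neg]
    rw [intervalIntegral.integral_comp_sub_left (fun t => g k t * iterInt g w t (1 - b)) 1,
      ← intervalIntegral.integral_symm]

theorem exists_hasRegValue_iterInt_half (hg : ∀ k, ContinuousOn (g k) (Set.Ioo 0 1))
    (h0 : ∀ k, ∃ c : ℂ, (fun t : ℝ => g k t - c / t) =O[𝓝[>] (0 : ℝ)] (fun _ => (1 : ℝ)))
    (w : List ℕ) : ∃ d, HasRegValue (fun x => iterInt g w x (1 / 2)) d := by
  induction w with
  | nil => exact ⟨1, hasRegValue_const 1⟩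
  | cons k w ih =>
    obtain ⟨c, hc⟩ := h0 k
    exact exists_hasRegValue_integral (hg k)
      (continuousOn_iterInt hg ⟨by norm_num, by norm_num⟩ w) hc ih

/-- Iterated integrals of forms with at most simple poles at `0` and `1` have an expansion. The
path is cut at `1/2`; the integrals from `1/2` to `1 - ε` are expressed through those from `1 - ε`
to `1/2` by means of the composition of the path from `1/2` to `1 - ε` with its inverse. -/
theorem exists_hasRegValue_iterInt (hg : ∀ k, ContinuousOn (g k) (Set.Ioo 0 1))
    (h0 : ∀ k, ∃ c : ℂ, (fun t : ℝ => g k t - c / t) =O[𝓝[>] (0 : ℝ)] (fun _ => (1 : ℝ)))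
    (h1 : ∀ k, ∃ c : ℂ, (fun t : ℝ => g k (1 - t) - c / t) =O[𝓝[>] (0 : ℝ)] (fun _ => (1 : ℝ)))
    (w : List ℕ) : ∃ d, HasRegValue (fun ε => iterInt g w ε (1 - ε)) d := by
  have hhalf : (1 / 2 : ℝ) ∈ Set.Ioo (0 : ℝ) 1 := ⟨by norm_num, by norm_num⟩
  have hmaps : Set.MapsTo (fun t : ℝ => 1 - t) (Set.Ioo 0 1) (Set.Ioo 0 1) :=
    fun t ht => ⟨by linarith [ht.2], by linarith [ht.1]⟩
  have hend : ∀ w : List ℕ, ∃ d, HasRegValue (fun ε => iterInt g w (1 - ε) (1 / 2)) d := by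
    intro w
    obtain ⟨d, hd⟩ := exists_hasRegValue_iterInt_half (g := fun k t => -g k (1 - t))
      (fun k => ((hg k).comp (by fun_prop) hmaps).neg)
      (fun k => by
        obtain ⟨c, hc⟩ := h1 k
        exact ⟨-c, hc.neg_left.congr_left fun t => by ring⟩) w
    refine ⟨d, hd.congr (Eventually.of_forall fun ε => ?_)⟩
    simp only [iterInt_comp_one_sub]
    norm_num
  have hstart : ∀ (n : ℕ) (w : List ℕ), w.length = n →
      ∃ d, HasRegValue (fun ε => iterInt g w (1 / 2) (1 - ε)) d := by
    intro n
    induction n using Nat.strong_induction_on with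
    | _ n ih =>
      intro w hw
      rcases w with _ | ⟨k, w⟩
      · exact ⟨1, hasRegValue_const 1⟩
      · obtain ⟨d, hd⟩ := exists_hasRegValue_finset_sum
          (F := fun i ε => iterInt g ((k :: w).take i) (1 / 2) (1 - ε) *
            iterInt g ((k :: w).drop i) (1 - ε) (1 / 2))
          (Finset.range (w.length + 1)) fun i hi => by
            have hi' : i < w.length + 1 := Finset.mem_range.1 hi
            obtain ⟨c, hc⟩ := ih i (by simpa [← hw] using hi') ((k :: w).take i)
              (by simp; omega)
            obtain ⟨d, hd⟩ := hend ((k :: w).drop i)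
            exact ⟨_, hc.mul hd⟩
        refine ⟨_, (hd.const_mul (-1)).congr ?_⟩
        filter_upwards [Ioo_mem_nhdsGT (zero_lt_one (α := ℝ))] with ε hε
        have hcomp := iterInt_eq_sum_take_drop hg hhalf (hmaps hε) hhalf (k :: w)
        have hzero : iterInt g (k :: w) (1 / 2) (1 / 2) = 0 := intervalIntegral.integral_same
        rw [hzero, List.length_cons, Finset.sum_range_succ] at hcomp
        have htake : (k :: w).take (w.length + 1) = k :: w := List.take_length (l := k :: w)
        have hdrop : (k :: w).drop (w.length + 1) = [] := List.drop_length (l := k :: w)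
        rw [htake, hdrop, iterInt, mul_one] at hcomp
        rw [neg_one_mul, neg_eq_iff_add_eq_zero, ← hcomp]
  obtain ⟨d, hd⟩ := exists_hasRegValue_finset_sum
    (F := fun i ε => iterInt g (w.take i) ε (1 / 2) * iterInt g (w.drop i) (1 / 2) (1 - ε))
    (Finset.range (w.length + 1)) fun i _ => by
      obtain ⟨c, hc⟩ := exists_hasRegValue_iterInt_half hg h0 (w.take i)
      obtain ⟨d, hd⟩ := hstart _ (w.drop i) rfl
      exact ⟨_, hc.mul hd⟩
  refine ⟨d, hd.congr ?_⟩
  filter_upwards [Ioo_mem_nhdsGT (zero_lt_one (α := ℝ))] with ε hε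
  exact (iterInt_eq_sum_take_drop hg hε hhalf (hmaps hε) w).symm

end IterInt

/-! ### Gaussian binomial coefficients and the finite Jacobi triple product -/

/-- The Gaussian binomial coefficient, defined by the `q`-Pascal rule. -/
def gaussBinom (q : ℂ) : ℕ → ℕ → ℂ
  | _, 0 => 1
  | 0, _ + 1 => 0
  | n + 1, k + 1 => gaussBinom q n k + q ^ (k + 1) * gaussBinom q n (k + 1)

/-- The `q`-Pochhammer symbol `(q; q)_m = ∏_{i=1}^m (1 - q^i)`. -/
def qPoch (q : ℂ) (m : ℕ) : ℂ := ∏ i ∈ Finset.range m, (1 - q ^ (i + 1))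

theorem gaussBinom_zero_right (q : ℂ) (n : ℕ) : gaussBinom q n 0 = 1 := by
  cases n <;> rfl

theorem gaussBinom_succ_succ (q : ℂ) (n k : ℕ) :
    gaussBinom q (n + 1) (k + 1) = gaussBinom q n k + q ^ (k + 1) * gaussBinom q n (k + 1) := rfl

theorem gaussBinom_eq_zero (q : ℂ) {n k : ℕ} (h : n < k) : gaussBinom q n k = 0 := by
  induction n generalizing k with
  | zero =>
    obtain ⟨k, rfl⟩ := Nat.exists_eq_succ_of_ne_zero h.ne'
    rfl
  | succ n ih =>
    obtain ⟨k, rfl⟩ := Nat.exists_eq_succ_of_ne_zero (Nat.ne_zero_of_lt h)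
    rw [Nat.succ_eq_add_one, gaussBinom_succ_succ, ih (by omega), ih (by omega), mul_zero, add_zero]

theorem qPoch_succ (q : ℂ) (m : ℕ) : qPoch q (m + 1) = qPoch q m * (1 - q ^ (m + 1)) :=
  Finset.prod_range_succ _ _

theorem gaussBinom_mul_qPoch (q : ℂ) (m k : ℕ) :
    gaussBinom q (m + k) k * (qPoch q k * qPoch q m) = qPoch q (m + k) := by
  induction k generalizing m with
  | zero => simp [gaussBinom_zero_right, qPoch]
  | succ k ihk =>
    induction m with
    | zero =>
      have := ihk 0
      rw [zero_add] at this ⊢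
      rw [gaussBinom_succ_succ, gaussBinom_eq_zero q (Nat.lt_succ_self k), qPoch_succ]
      linear_combination (1 - q ^ (k + 1)) * this
    | succ m ihm =>
      have h := ihk (m + 1)
      rw [← add_assoc, gaussBinom_succ_succ, qPoch_succ q (m + 1 + k)]
      rw [show m + (k + 1) = m + 1 + k by ring] at ihm
      calc _ = gaussBinom q (m + 1 + k) k * (qPoch q k * qPoch q (m + 1)) * (1 - q ^ (k + 1))
            + q ^ (k + 1) * (1 - q ^ (m + 1)) *
              (gaussBinom q (m + 1 + k) (k + 1) * (qPoch q (k + 1) * qPoch q m)) := by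
            rw [qPoch_succ q k, qPoch_succ q m]; ring
        _ = _ := by rw [h, ihm]; ring

/-- The `q`-binomial theorem. -/
theorem prod_one_add_pow_mul (q x : ℂ) (n : ℕ) :
    ∏ i ∈ Finset.range n, (1 + q ^ i * x) =
      ∑ k ∈ Finset.range (n + 1), q ^ k.choose 2 * gaussBinom q n k * x ^ k := by
  induction n generalizing x with
  | zero => simp [gaussBinom_zero_right]
  | succ n ih =>
    have h : ∏ i ∈ Finset.range n, (1 + q ^ (i + 1) * x) =
        ∑ k ∈ Finset.range (n + 1), q ^ k.choose 2 * gaussBinom q n k * (q * x) ^ k := by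
      rw [← ih]
      exact Finset.prod_congr rfl fun i _ => by ring
    rw [Finset.prod_range_succ', h, Finset.sum_range_succ' _ (n + 1), pow_zero, one_mul, mul_add,
      mul_one]
    have h₁ : ∑ k ∈ Finset.range (n + 1), q ^ k.choose 2 * gaussBinom q n k * (q * x) ^ k =
        (∑ k ∈ Finset.range (n + 1),
          q ^ (k + 1).choose 2 * gaussBinom q n (k + 1) * (q * x) ^ (k + 1)) + 1 := by
      rw [Finset.sum_range_succ', Finset.sum_range_succ _ n, gaussBinom_eq_zero q n.lt_succ_self]
      simp [gaussBinom_zero_right]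
    nth_rewrite 1 [h₁]
    rw [Finset.sum_mul, add_right_comm, ← Finset.sum_add_distrib]
    congr 1
    · refine Finset.sum_congr rfl fun k _ => ?_
      rw [gaussBinom_succ_succ, Nat.choose_succ_succ' k 1, Nat.choose_one_right]
      ring
    · simp [gaussBinom_zero_right]

/-- The finite form of the Jacobi triple product; `a n` stands for `(-1)^n q^{n(n+1)/2} w^n`. -/
theorem finite_triple_product {q w : ℂ} (hq : q ≠ 0) (hw : w ≠ 0) {a : ℤ → ℂ} (h0 : a 0 = 1)
    (ha : ∀ n, a (n + 1) = -(q ^ (n + 1) * w) * a n) (N : ℕ) :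
    ∏ i ∈ Finset.range N, ((1 - q ^ (i + 1) * w) * (1 - q ^ i * w⁻¹)) =
      ∑ k ∈ Finset.range (2 * N + 1), gaussBinom q (2 * N) k * a (k - N) := by
  -- In the `q`-binomial theorem for `∏ (1 + q^i x)`, `i < 2N`, the factors with `i ≥ N` are the
  -- `1 - q^{i-N+1} w`; in those with `i < N` the term `q^i x` is pulled out, which gives `K N`.
  set x : ℂ := -(q ^ (1 - N : ℤ) * w) with hx
  set K : ℕ → ℂ := fun N => ∏ i ∈ Finset.range N, (-(q ^ (-i : ℤ) * w)) with hK
  have hKne : K N ≠ 0 := Finset.prod_ne_zero_iff.2 fun i _ =>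
    neg_ne_zero.2 (mul_ne_zero (zpow_ne_zero _ hq) hw)
  have hKa : ∀ N : ℕ, K N * a (-N) = 1 := by
    intro N
    induction N with
    | zero => simp [hK, h0]
    | succ N ih =>
      have e := ha (-(N + 1 : ℕ))
      rw [show (-((N + 1 : ℕ) : ℤ) + 1) = -N by push_cast; ring] at e
      rw [← ih, e]
      simp only [hK, Finset.prod_range_succ]
      ring
  have hterm : ∀ k : ℕ, q ^ k.choose 2 * x ^ k = K N * a (k - N) := by
    intro k
    induction k with
    | zero => simp [hKa]
    | succ k ih =>
      have e := ha (k - N)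
      rw [show ((k + 1 : ℕ) : ℤ) - N = k - N + 1 by push_cast; ring, e,
        Nat.choose_succ_succ' k 1, Nat.choose_one_right]
      have hqk : q ^ (k - N + 1 : ℤ) = q ^ k * q ^ (1 - N : ℤ) := by
        rw [← zpow_natCast, ← zpow_add₀ hq]
        congr 1
        ring
      calc _ = (q ^ k.choose 2 * x ^ k) * (q ^ k * x) := by ring
        _ = _ := by rw [ih, hqk, hx]; ring
  have hprod : ∏ i ∈ Finset.range (2 * N), (1 + q ^ i * x) =
      K N * ∏ i ∈ Finset.range N, ((1 - q ^ (i + 1) * w) * (1 - q ^ i * w⁻¹)) := by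
    have h₁ : ∏ i ∈ Finset.range N, (1 + q ^ (N - 1 - i) * x) =
        K N * ∏ i ∈ Finset.range N, (1 - q ^ i * w⁻¹) := by
      rw [hK, ← Finset.prod_mul_distrib]
      refine Finset.prod_congr rfl fun i hi => ?_
      have hi' : i < N := Finset.mem_range.1 hi
      have e : q ^ (N - 1 - i) * q ^ (1 - N : ℤ) = q ^ (-i : ℤ) := by
        rw [← zpow_natCast, ← zpow_add₀ hq]
        congr 1
        omega
      have e' : q ^ (-i : ℤ) * q ^ i = 1 := by
        rw [zpow_neg, zpow_natCast, inv_mul_cancel₀ (pow_ne_zero _ hq)]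
      calc _ = 1 - (q ^ (N - 1 - i) * q ^ (1 - N : ℤ)) * w := by rw [hx]; ring
        _ = (q ^ (-i : ℤ) * q ^ i) * (w * w⁻¹) - q ^ (-i : ℤ) * w := by
          rw [e, e', mul_inv_cancel₀ hw, one_mul]
        _ = _ := by ring
    have h₂ : ∏ i ∈ Finset.range N, (1 + q ^ (N + i) * x) =
        ∏ i ∈ Finset.range N, (1 - q ^ (i + 1) * w) := by
      refine Finset.prod_congr rfl fun i _ => ?_
      have e : q ^ (N + i) * q ^ (1 - N : ℤ) = q ^ (i + 1) := by
        rw [← zpow_natCast, ← zpow_add₀ hq, ← zpow_natCast]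
        congr 1
        push_cast
        ring
      rw [hx, mul_neg, ← mul_assoc, e, ← sub_eq_add_neg]
    rw [two_mul, Finset.prod_range_add, ← Finset.prod_range_reflect, h₁, h₂,
      Finset.prod_mul_distrib]
    ring
  refine mul_left_cancel₀ hKne ?_
  rw [← hprod, prod_one_add_pow_mul, Finset.mul_sum]
  refine Finset.sum_congr rfl fun k _ => ?_
  rw [mul_right_comm, hterm]
  ring

theorem tendsto_qPoch {q : ℂ} (hq : ‖q‖ < 1) : ∃ L, L ≠ 0 ∧ Tendsto (qPoch q) atTop (𝓝 L) := by
  have hs : Summable fun i : ℕ => ‖-q ^ (i + 1)‖ := by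
    simpa only [norm_neg, norm_pow] using
      (summable_nat_add_iff 1).2 (summable_geometric_of_lt_one (norm_nonneg q) hq)
  refine ⟨∏' i : ℕ, (1 + -q ^ (i + 1)), tprod_one_add_ne_zero_of_summable (fun i h => ?_) hs, ?_⟩
  · have h1 : q ^ (i + 1) = 1 := by linear_combination -h
    have h2 := congrArg norm h1
    rw [norm_pow, norm_one] at h2
    exact (pow_lt_one₀ (norm_nonneg q) hq i.succ_ne_zero).ne h2
  · have := (multipliable_one_add_of_summable hs).hasProd.tendsto_prod_nat
    simp only [← sub_eq_add_neg] at this ⊢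
    exact this

theorem qPoch_ne_zero {q : ℂ} (hq : ‖q‖ < 1) (m : ℕ) : qPoch q m ≠ 0 := by
  refine Finset.prod_ne_zero_iff.2 fun i _ h => ?_
  have h2 := congrArg norm (sub_eq_zero.1 h)
  rw [norm_pow, norm_one] at h2
  exact (pow_lt_one₀ (norm_nonneg q) hq i.succ_ne_zero).ne' h2

theorem exists_norm_qPoch_bounds {q : ℂ} (hq : ‖q‖ < 1) :
    ∃ d B : ℝ, 0 < d ∧ ∀ m, d ≤ ‖qPoch q m‖ ∧ ‖qPoch q m‖ ≤ B := by
  obtain ⟨L, hL, ht⟩ := tendsto_qPoch hq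
  obtain ⟨B, hB⟩ := ht.norm.bddAbove_range
  obtain ⟨D, hD⟩ := (ht.inv₀ hL).norm.bddAbove_range
  have hD' : ∀ m, ‖qPoch q m‖⁻¹ ≤ D := fun m => by
    simpa using hD ⟨m, rfl⟩
  have hpos : ∀ m, 0 < ‖qPoch q m‖ := fun m => norm_pos_iff.2 (qPoch_ne_zero hq m)
  have hD0 : 0 < D := (inv_pos.2 (hpos 0)).trans_le (hD' 0)
  exact ⟨D⁻¹, B, inv_pos.2 hD0, fun m =>
    ⟨inv_le_of_inv_le₀ (hpos m) (hD' m), hB ⟨m, rfl⟩⟩⟩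

/-- The central Gaussian binomial coefficient `[2N, N + n]`, as a function of an integer `n`. -/
def centralGaussBinom (q : ℂ) (N : ℕ) (n : ℤ) : ℂ :=
  if -N ≤ n then gaussBinom q (2 * N) (n + N).toNat else 0

theorem sum_gaussBinom_eq_tsum (q : ℂ) (N : ℕ) (a : ℤ → ℂ) :
    ∑ k ∈ Finset.range (2 * N + 1), gaussBinom q (2 * N) k * a (k - N) =
      ∑' n : ℤ, centralGaussBinom q N n * a n := by
  classical
  rw [tsum_eq_sum (s := (Finset.range (2 * N + 1)).image fun k : ℕ => (k : ℤ) - N),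
    Finset.sum_image fun i _ j _ h => by simpa using h]
  · refine Finset.sum_congr rfl fun k _ => ?_
    rw [centralGaussBinom, if_pos (by omega)]
    simp
  · intro n hn
    rw [centralGaussBinom]
    split_ifs with h
    · rw [gaussBinom_eq_zero, zero_mul]
      by_contra hlt
      refine hn (Finset.mem_image.2 ⟨(n + N).toNat, Finset.mem_range.2 (by omega), by omega⟩)
    · exact zero_mul _

theorem centralGaussBinom_eq {q : ℂ} (hq : ‖q‖ < 1) {N : ℕ} {n : ℤ} (h₁ : -N ≤ n) (h₂ : n ≤ N) :
    centralGaussBinom q N n =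
      qPoch q (2 * N) / (qPoch q (N + n).toNat * qPoch q (N - n).toNat) := by
  rw [centralGaussBinom, if_pos h₁,
    eq_div_iff (mul_ne_zero (qPoch_ne_zero hq _) (qPoch_ne_zero hq _))]
  have h := gaussBinom_mul_qPoch q (N - n).toNat (N + n).toNat
  rw [show (N - n).toNat + (N + n).toNat = 2 * N by omega] at h
  rwa [add_comm n]

theorem exists_norm_centralGaussBinom_le {q : ℂ} (hq : ‖q‖ < 1) :
    ∃ B : ℝ, ∀ N n, ‖centralGaussBinom q N n‖ ≤ B := by
  obtain ⟨d, B, hd, hB⟩ := exists_norm_qPoch_bounds hq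
  have hB0 : 0 ≤ B := (norm_nonneg _).trans (hB 0).2
  refine ⟨B / (d * d), fun N n => ?_⟩
  by_cases h₁ : -N ≤ n
  · by_cases h₂ : n ≤ N
    · rw [centralGaussBinom_eq hq h₁ h₂, norm_div, norm_mul]
      exact div_le_div₀ hB0 (hB _).2 (by positivity)
        (mul_le_mul (hB _).1 (hB _).1 hd.le (norm_nonneg _))
    · rw [centralGaussBinom, if_pos h₁, gaussBinom_eq_zero q (by omega), norm_zero]
      positivity
  · rw [centralGaussBinom, if_neg h₁, norm_zero]
    positivity

theorem tendsto_centralGaussBinom {q L : ℂ} (hq : ‖q‖ < 1) (hL : L ≠ 0)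
    (ht : Tendsto (qPoch q) atTop (𝓝 L)) (n : ℤ) :
    Tendsto (fun N => centralGaussBinom q N n) atTop (𝓝 L⁻¹) := by
  have h2 : Tendsto (fun N : ℕ => 2 * N) atTop atTop :=
    tendsto_atTop_mono (fun N => Nat.le_mul_of_pos_left N two_pos) tendsto_id
  have hp : ∀ m : ℤ, Tendsto (fun N : ℕ => (N + m).toNat) atTop atTop := fun m =>
    tendsto_atTop.2 fun b => by
      filter_upwards [eventually_ge_atTop (b + m.natAbs)] with N hN
      omega
  have h := (ht.comp h2).div ((ht.comp (hp n)).mul (ht.comp (hp (-n)))) (mul_ne_zero hL hL)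
  rw [show L / (L * L) = L⁻¹ by field_simp] at h
  refine h.congr' ?_
  filter_upwards [eventually_ge_atTop n.natAbs] with N hN
  rw [centralGaussBinom_eq hq (by omega) (by omega), sub_eq_add_neg]
  rfl

/-- A lower bound, uniform in `w` on the unit circle, for the theta series with terms
`a n = (-1)^n q^{n(n+1)/2} w^n`. In the finite triple product the factor `1 - w⁻¹` stands out, and
the other factors are at least `1 - |q|^i`; the sums of the finite identity tend to
`(∑ a n) / (q; q)_∞`. -/
theorem exists_le_norm_tsum {q : ℂ} (hq0 : q ≠ 0) (hq : ‖q‖ < 1) :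
    ∃ C : ℝ, 0 < C ∧ ∀ (w : ℂ) (a : ℤ → ℂ), ‖w‖ = 1 → a 0 = 1 →
      (∀ n, a (n + 1) = -(q ^ (n + 1) * w) * a n) → Summable (fun n => ‖a n‖) →
      C * ‖1 - w⁻¹‖ ≤ ‖∑' n, a n‖ := by
  obtain ⟨L, hL, ht⟩ := tendsto_qPoch hq
  obtain ⟨B, hB⟩ := exists_norm_centralGaussBinom_le hq
  have hqr : ‖((‖q‖ : ℝ) : ℂ)‖ < 1 := by simpa using hq
  obtain ⟨d, _, hd, hdle⟩ := exists_norm_qPoch_bounds hqr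
  have hnorm : ∀ m, ‖qPoch (‖q‖ : ℝ) m‖ = ∏ i ∈ Finset.range m, (1 - ‖q‖ ^ (i + 1)) := by
    intro m
    have hnn : ∀ i ∈ Finset.range m, 0 ≤ 1 - ‖q‖ ^ (i + 1) := fun i _ =>
      sub_nonneg.2 (pow_le_one₀ (norm_nonneg q) hq.le)
    have : qPoch (‖q‖ : ℝ) m = ((∏ i ∈ Finset.range m, (1 - ‖q‖ ^ (i + 1)) : ℝ) : ℂ) := by
      simp [qPoch]
    rw [this, Complex.norm_real, Real.norm_of_nonneg (Finset.prod_nonneg hnn)]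
  have hlow : ∀ (m : ℕ) (u : ℂ), ‖u‖ = 1 →
      d ≤ ‖∏ i ∈ Finset.range m, (1 - q ^ (i + 1) * u)‖ := by
    intro m u hu
    refine (hdle m).1.trans ?_
    rw [hnorm, norm_prod]
    refine Finset.prod_le_prod (fun i _ =>
      sub_nonneg.2 (pow_le_one₀ (norm_nonneg q) hq.le)) fun i _ => ?_
    have := norm_sub_norm_le (1 : ℂ) (q ^ (i + 1) * u)
    rwa [norm_one, norm_mul, norm_pow, hu, mul_one] at this
  refine ⟨‖L‖ * (d * d), by have := norm_pos_iff.2 hL; positivity, ?_⟩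
  intro w a hw h0 ha hs
  have hw0 : w ≠ 0 := norm_pos_iff.1 (hw ▸ one_pos)
  have hw' : ‖w⁻¹‖ = 1 := by rw [norm_inv, hw, inv_one]
  have hlim : Tendsto (fun N => ∑' n : ℤ, centralGaussBinom q N n * a n) atTop
      (𝓝 (∑' n : ℤ, L⁻¹ * a n)) := by
    refine tendsto_tsum_of_dominated_convergence (hs.mul_left B)
      (fun n => (tendsto_centralGaussBinom hq hL ht n).mul_const _)
      (Eventually.of_forall fun N n => ?_)
    rw [norm_mul]
    exact mul_le_mul_of_nonneg_right (hB N n) (norm_nonneg _)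
  rw [tsum_mul_left] at hlim
  have hge : ∀ᶠ N in atTop, d * d * ‖1 - w⁻¹‖ ≤ ‖∑' n : ℤ, centralGaussBinom q N n * a n‖ := by
    filter_upwards [eventually_ge_atTop 1] with N hN
    obtain ⟨N, rfl⟩ := Nat.exists_eq_add_of_le' hN
    rw [← sum_gaussBinom_eq_tsum, ← finite_triple_product hq0 hw0 h0 ha, Finset.prod_mul_distrib,
      Finset.prod_range_succ' (fun i => 1 - q ^ i * w⁻¹), pow_zero, one_mul, norm_mul, norm_mul,
      ← mul_assoc]
    exact mul_le_mul_of_nonneg_right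
      (mul_le_mul (hlow _ w hw) (hlow _ _ hw') hd.le (norm_nonneg _)) (norm_nonneg _)
  have hfin := ge_of_tendsto hlim.norm hge
  rw [norm_mul, norm_inv] at hfin
  have hLpos := norm_pos_iff.2 hL
  rwa [mul_assoc, ← le_inv_mul_iff₀ hLpos]

/-! ### The theta function on the real line -/

theorem theta_eq (τ : ℍ) (z : ℂ) :
    theta τ z = Complex.exp (Real.pi * Complex.I * (τ / 4 + z)) *
      jacobiTheta₂ (z + (τ + 1) / 2) τ := by
  rw [theta, jacobiTheta₂, ← tsum_mul_left]
  refine tsum_congr fun n => ?_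
  have h : (-1 : ℂ) ^ n = Complex.exp (n * (Real.pi * Complex.I)) := by
    rw [Complex.exp_int_mul, Complex.exp_pi_mul_I]
  rw [h, jacobiTheta₂_term, ← Complex.exp_add, ← Complex.exp_add, ← Complex.exp_add]
  congr 1
  ring

theorem differentiable_theta (τ : ℍ) : Differentiable ℂ (theta τ) := by
  intro z
  have h : theta τ = fun z => Complex.exp (Real.pi * Complex.I * (τ / 4 + z)) *
      jacobiTheta₂ (z + (τ + 1) / 2) τ := funext (theta_eq τ)
  rw [h]
  refine DifferentiableAt.mul (by fun_prop) ?_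
  have h₁ := differentiableAt_jacobiTheta₂_fst (z + (τ + 1) / 2) τ.im_pos
  have h₂ : DifferentiableAt ℂ (fun z : ℂ => z + ((τ : ℂ) + 1) / 2) z := by fun_prop
  exact h₁.fun_comp' z h₂

theorem theta_add_one (τ : ℍ) (z : ℂ) : theta τ (z + 1) = -theta τ z := by
  rw [theta_eq, theta_eq, add_right_comm z 1, jacobiTheta₂_add_left, ← add_assoc, mul_add _ _ 1,
    mul_one, Complex.exp_add, Complex.exp_pi_mul_I]
  ring

theorem theta_zero (τ : ℍ) : theta τ 0 = 0 := by
  have h₁ := jacobiTheta₂_add_left' ((1 - τ) / 2) τ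
  have h₂ := jacobiTheta₂_add_left (-((1 - τ) / 2)) (τ : ℂ)
  rw [jacobiTheta₂_neg_left] at h₂
  rw [show ((1 - τ) / 2 + τ : ℂ) = (τ + 1) / 2 by ring,
    show (-Real.pi * Complex.I * (τ + 2 * ((1 - τ) / 2)) : ℂ) = -(Real.pi * Complex.I) by ring,
    Complex.exp_neg, Complex.exp_pi_mul_I, ← h₂,
    show (-((1 - τ) / 2) + 1 : ℂ) = (τ + 1) / 2 by ring] at h₁
  have h₃ : jacobiTheta₂ ((τ + 1) / 2 : ℂ) τ = 0 := by
    norm_num at h₁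
    linear_combination h₁ / 2
  rw [theta_eq, zero_add, h₃, mul_zero]

theorem exists_le_norm_theta (τ : ℍ) :
    ∃ C : ℝ, 0 < C ∧ ∀ x : ℝ,
      C * ‖1 - Complex.exp (-(2 * Real.pi * Complex.I * x))‖ ≤ ‖theta τ x‖ := by
  have hq : ‖Complex.exp (2 * Real.pi * Complex.I * τ)‖ < 1 := by
    simpa [Function.Periodic.qParam] using UpperHalfPlane.norm_qParam_lt_one 1 τ
  obtain ⟨C, hC, h⟩ := exists_le_norm_tsum (Complex.exp_ne_zero _) hq
  refine ⟨‖Complex.exp (Real.pi * Complex.I * (τ / 4))‖ * C,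
    mul_pos (norm_pos_iff.2 (Complex.exp_ne_zero _)) hC, fun x => ?_⟩
  have hx : ∀ y : ℝ, ‖Complex.exp (y * Complex.I)‖ = 1 := Complex.norm_exp_ofReal_mul_I
  have h1 : ‖theta τ x‖ = ‖Complex.exp (Real.pi * Complex.I * (τ / 4))‖ *
      ‖∑' n : ℤ, jacobiTheta₂_term n (x + (τ + 1) / 2) τ‖ := by
    rw [theta_eq, norm_mul, mul_add, Complex.exp_add, norm_mul,
      show (Real.pi * Complex.I * x : ℂ) = ((Real.pi * x : ℝ) : ℂ) * Complex.I by
        push_cast; ring, hx, mul_one]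
    rfl
  rw [h1, mul_assoc, Complex.exp_neg]
  refine mul_le_mul_of_nonneg_left (h _ _ ?_ ?_ ?_ ?_) (norm_nonneg _)
  · rw [show (2 * Real.pi * Complex.I * x : ℂ) = ((2 * Real.pi * x : ℝ) : ℂ) * Complex.I by
        push_cast; ring, hx]
  · simp [jacobiTheta₂_term]
  · intro n
    have e : -(1 : ℂ) = Complex.exp (Real.pi * Complex.I) := Complex.exp_pi_mul_I.symm
    rw [neg_eq_neg_one_mul, e, ← Complex.exp_int_mul, jacobiTheta₂_term, jacobiTheta₂_term,
      ← Complex.exp_add, ← Complex.exp_add, ← Complex.exp_add]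
    congr 1
    push_cast
    ring
  · exact ((summable_jacobiTheta₂_term_iff _ _).2 τ.im_pos).norm

theorem theta_ne_zero (τ : ℍ) {x : ℝ} (hx : x ∈ Set.Ioo (0 : ℝ) 1) : theta τ x ≠ 0 := by
  obtain ⟨C, hC, h⟩ := exists_le_norm_theta τ
  intro h0
  have h1 := h x
  rw [h0, norm_zero] at h1
  have h2 : ‖1 - Complex.exp (-(2 * Real.pi * Complex.I * x))‖ ≤ 0 :=
    nonpos_of_mul_nonpos_right h1 hC
  have h3 := (sub_eq_zero.1 (norm_le_zero_iff.1 h2)).symm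
  obtain ⟨n, hn⟩ := Complex.exp_eq_one_iff.1 h3
  have h4 : (x : ℂ) = ((-n : ℤ) : ℂ) := by
    have hpi : (2 * Real.pi * Complex.I : ℂ) ≠ 0 := Complex.two_pi_I_ne_zero
    refine mul_left_cancel₀ hpi ?_
    push_cast
    linear_combination -hn
  have h5 : x = ((-n : ℤ) : ℝ) := by exact_mod_cast h4
  rw [h5] at hx
  have h6 : (0 : ℤ) < -n := by exact_mod_cast hx.1
  have h7 : -n < (1 : ℤ) := by exact_mod_cast hx.2
  omega

theorem deriv_theta_zero_ne_zero (τ : ℍ) : deriv (theta τ) 0 ≠ 0 := by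
  obtain ⟨C, hC, h⟩ := exists_le_norm_theta τ
  intro h0
  have hd := (differentiable_theta τ 0).hasDerivAt
  rw [h0] at hd
  -- A vanishing derivative of `θ` would force the derivative of `e^{-2πix}` to vanish at `0`.
  have hd' : HasDerivAt (fun x : ℝ => theta τ x) 0 0 :=
    HasDerivAt.comp_ofReal (z := 0) (by simpa using hd)
  have ho := hd'.isLittleO
  simp only [Complex.ofReal_zero, theta_zero, sub_zero, smul_zero] at ho
  have hO : (fun x : ℝ => Complex.exp (-(2 * Real.pi * Complex.I * x)) - 1)
      =O[𝓝 0] fun x : ℝ => theta τ x := by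
    refine IsBigO.of_bound C⁻¹ (Eventually.of_forall fun x => ?_)
    rw [norm_sub_rev, inv_mul_eq_div, le_div_iff₀ hC, mul_comm]
    exact h x
  have he : HasDerivAt (fun x : ℝ => Complex.exp (-(2 * Real.pi * Complex.I * x))) 0 0 := by
    refine HasDerivAt.of_isLittleO ?_
    simpa using hO.trans_isLittleO ho
  have he' : HasDerivAt (fun x : ℝ => Complex.exp (-(2 * Real.pi * Complex.I * x)))
      (-(2 * Real.pi * Complex.I)) 0 := by
    have h1 : HasDerivAt (fun z : ℂ => Complex.exp (-(2 * Real.pi * Complex.I * z)))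
        (-(2 * Real.pi * Complex.I)) ((0 : ℝ) : ℂ) := by
      have := (((hasDerivAt_id ((0 : ℝ) : ℂ)).const_mul (2 * Real.pi * Complex.I)).neg).cexp
      simpa using this
    exact h1.comp_ofReal
  exact Complex.two_pi_I_ne_zero (neg_eq_zero.1 (he'.unique he))

/-! ### The coefficients of the Eisenstein-Kronecker series -/

theorem differentiable_dslope {f : ℂ → ℂ} (hf : Differentiable ℂ f) :
    Differentiable ℂ (dslope f 0) :=
  differentiableOn_univ.1
    ((Complex.differentiableOn_dslope univ_mem).2 hf.differentiableOn)

/-- A quotient of entire functions whose denominator has a simple zero at `0` has at most a simple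
pole there. -/
theorem exists_isBigO_div_sub {N θ : ℂ → ℂ} (hN : Differentiable ℂ N) (hθ : Differentiable ℂ θ)
    (h0 : θ 0 = 0) (h1 : deriv θ 0 ≠ 0) :
    ∃ c : ℂ, (fun z => N z / θ z - c / z) =O[𝓝[≠] (0 : ℂ)] (fun _ => (1 : ℝ)) := by
  set φ := dslope θ 0 with hφ
  have hφd : Differentiable ℂ φ := differentiable_dslope hθ
  have hφ0 : φ 0 = deriv θ 0 := dslope_same θ 0
  set c := N 0 / deriv θ 0 with hc
  set H : ℂ → ℂ := fun z => N z - c * φ z with hH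
  have hHd : Differentiable ℂ H := hN.sub (hφd.const_mul c)
  have hH0 : H 0 = 0 := by simp only [hH, hφ0, hc]; field_simp; ring
  refine ⟨c, ?_⟩
  have hcont : ContinuousAt (fun z => dslope H 0 z / φ z) 0 :=
    (differentiable_dslope hHd).continuous.continuousAt.div hφd.continuous.continuousAt
      (hφ0 ▸ h1)
  refine ((hcont.tendsto.mono_left nhdsWithin_le_nhds).isBigO_one ℝ).congr' ?_ EventuallyEq.rfl
  have hne : ∀ᶠ z in 𝓝[≠] (0 : ℂ), φ z ≠ 0 :=
    nhdsWithin_le_nhds (hφd.continuous.continuousAt.eventually_ne (hφ0 ▸ h1))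
  filter_upwards [hne, self_mem_nhdsWithin] with z hz hz0
  have hz0' : z ≠ 0 := hz0
  have e : θ z = z * φ z := by
    rw [hφ, dslope_of_ne _ hz0', slope_def_field, h0]
    field_simp
    ring
  rw [dslope_of_ne _ hz0', slope_def_field, hH0, e]
  simp only [hH]
  field_simp
  ring

/-- The factor `α θ'(0) / θ(α)` of `α F(α, z)`, with its removable singularity at `α = 0`
removed. -/
def alphaFactor (τ : ℍ) (α : ℂ) : ℂ := deriv (theta τ) 0 / dslope (theta τ) 0 α

theorem alphaFactor_zero (τ : ℍ) : alphaFactor τ 0 = 1 := by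
  rw [alphaFactor, dslope_same, div_self (deriv_theta_zero_ne_zero τ)]

theorem analyticAt_alphaFactor (τ : ℍ) : AnalyticAt ℂ (alphaFactor τ) 0 := by
  refine analyticAt_const.div ((differentiable_dslope (differentiable_theta τ)).analyticAt 0) ?_
  rw [dslope_same]
  exact deriv_theta_zero_ne_zero τ

/-- The function `α F(α, z)` without a singularity at `α = 0`. With the convention `x / 0 = 0` the
identity also holds at the zeros of `θ`. -/
theorem alphaEisensteinKronecker_eq (τ : ℍ) (z : ℂ) :
    alphaEisensteinKronecker τ z =
      fun α => theta τ (z + α) * alphaFactor τ α * (theta τ z)⁻¹ := by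
  have hne : ∀ α : ℂ, α ≠ 0 → α * eisensteinKronecker τ α z =
      theta τ (z + α) * alphaFactor τ α * (theta τ z)⁻¹ := by
    intro α hα
    rw [eisensteinKronecker, alphaFactor, dslope_of_ne _ hα, slope_def_field, theta_zero,
      sub_zero, sub_zero, div_div_eq_mul_div, div_eq_mul_inv, div_eq_mul_inv, mul_inv]
    ring
  have hcont : ContinuousAt (fun α => theta τ (z + α) * alphaFactor τ α * (theta τ z)⁻¹) 0 := by
    refine (ContinuousAt.mul ?_ (analyticAt_alphaFactor τ).continuousAt).mul continuousAt_const
    exact (differentiable_theta τ).continuous.continuousAt.comp (by fun_prop)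
  have hlim : Tendsto (fun α => α * eisensteinKronecker τ α z) (𝓝[≠] (0 : ℂ))
      (𝓝 (theta τ (z + 0) * alphaFactor τ 0 * (theta τ z)⁻¹)) := by
    refine (hcont.tendsto.mono_left nhdsWithin_le_nhds).congr' ?_
    filter_upwards [self_mem_nhdsWithin] with α hα
    exact (hne α hα).symm
  funext α
  rw [alphaEisensteinKronecker, hlim.limUnder_eq]
  rcases eq_or_ne α 0 with rfl | hα
  · rw [Function.update_self]
  · rw [Function.update_of_ne hα, hne α hα]

/-- The entire function `θ(z) f^{(n)}(z)`. -/
def kroneckerNumerator (τ : ℍ) (n : ℕ) (z : ℂ) : ℂ :=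
  iteratedDeriv n (fun α => theta τ (z + α) * alphaFactor τ α) 0 / (n.factorial : ℂ)

theorem kroneckerCoeff_eq (τ : ℍ) (n : ℕ) (z : ℂ) :
    kroneckerCoeff τ n z = kroneckerNumerator τ n z / theta τ z := by
  rw [kroneckerCoeff, alphaEisensteinKronecker_eq, iteratedDeriv_mul_const_field,
    kroneckerNumerator]
  ring

theorem differentiable_kroneckerNumerator (τ : ℍ) (n : ℕ) :
    Differentiable ℂ (kroneckerNumerator τ n) := by
  have hcd : ContDiff ℂ ⊤ (theta τ) := (differentiable_theta τ).contDiff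
  have h : kroneckerNumerator τ n = fun z => (∑ i ∈ Finset.range (n + 1),
      (n.choose i : ℂ) * iteratedDeriv i (theta τ) z * iteratedDeriv (n - i) (alphaFactor τ) 0) /
        (n.factorial : ℂ) := by
    funext z
    have h₁ : ContDiffAt ℂ n (fun α => theta τ (z + α)) 0 :=
      ((differentiable_theta τ).comp
        (by fun_prop : Differentiable ℂ fun α => z + α)).contDiff.contDiffAt
    rw [kroneckerNumerator, iteratedDeriv_fun_mul h₁ (analyticAt_alphaFactor τ).contDiffAt]
    simp only [iteratedDeriv_comp_const_add, add_zero]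
  rw [h]
  refine Differentiable.div_const (Differentiable.fun_sum fun i _ => ?_) _
  refine (Differentiable.const_mul ?_ _).mul_const _
  exact hcd.differentiable_iteratedDeriv i (WithTop.coe_lt_top _)

theorem kroneckerCoeff_add_one (τ : ℍ) (n : ℕ) (z : ℂ) :
    kroneckerCoeff τ n (z + 1) = kroneckerCoeff τ n z := by
  have h : ∀ α, eisensteinKronecker τ α (z + 1) = eisensteinKronecker τ α z := by
    intro α
    rw [eisensteinKronecker, eisensteinKronecker, add_right_comm, theta_add_one, theta_add_one,
      neg_mul, neg_mul, neg_div_neg_eq]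
  simp only [kroneckerCoeff, alphaEisensteinKronecker, h]

theorem kroneckerCoeff_zero (τ : ℍ) {x : ℝ} (hx : x ∈ Set.Ioo (0 : ℝ) 1) :
    kroneckerCoeff τ 0 x = 1 := by
  rw [kroneckerCoeff_eq, kroneckerNumerator, iteratedDeriv_zero, add_zero, alphaFactor_zero]
  simp [theta_ne_zero τ hx]

theorem continuousOn_kroneckerCoeff (τ : ℍ) (n : ℕ) :
    ContinuousOn (fun t : ℝ => kroneckerCoeff τ n t) (Set.Ioo 0 1) := by
  simp only [kroneckerCoeff_eq]
  exact ((differentiable_kroneckerNumerator τ n).continuous.comp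
    Complex.continuous_ofReal).continuousOn.div
      ((differentiable_theta τ).continuous.comp Complex.continuous_ofReal).continuousOn
      fun x hx => theta_ne_zero τ hx

/-- On the real line `f^{(n)}` has at most simple poles at `0` and, by periodicity, at `1`. -/
theorem exists_kroneckerCoeff_isBigO (τ : ℍ) (n : ℕ) :
    (∃ c : ℂ, (fun t : ℝ => kroneckerCoeff τ n t - c / t) =O[𝓝[>] (0 : ℝ)] fun _ => (1 : ℝ)) ∧
    ∃ c : ℂ, (fun t : ℝ => kroneckerCoeff τ n ((1 - t : ℝ) : ℂ) - c / t)
      =O[𝓝[>] (0 : ℝ)] fun _ => (1 : ℝ) := by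
  obtain ⟨c, hc⟩ := exists_isBigO_div_sub (differentiable_kroneckerNumerator τ n)
    (differentiable_theta τ) (theta_zero τ) (deriv_theta_zero_ne_zero τ)
  simp only [← kroneckerCoeff_eq] at hc
  have ht : Tendsto (fun t : ℝ => (t : ℂ)) (𝓝[>] (0 : ℝ)) (𝓝[≠] (0 : ℂ)) := by
    refine tendsto_nhdsWithin_iff.2 ⟨?_, ?_⟩
    · simpa using (Complex.continuous_ofReal.tendsto 0).mono_left nhdsWithin_le_nhds
    · filter_upwards [self_mem_nhdsWithin] with t ht
      exact Complex.ofReal_ne_zero.2 (ne_of_gt ht)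
  have ht' : Tendsto (fun t : ℝ => -(t : ℂ)) (𝓝[>] (0 : ℝ)) (𝓝[≠] (0 : ℂ)) := by
    refine tendsto_nhdsWithin_iff.2 ⟨?_, ?_⟩
    · have h : Continuous fun t : ℝ => -(t : ℂ) := by fun_prop
      simpa using (h.tendsto 0).mono_left nhdsWithin_le_nhds
    · filter_upwards [self_mem_nhdsWithin] with t ht
      exact neg_ne_zero.2 (Complex.ofReal_ne_zero.2 (ne_of_gt ht))
  refine ⟨⟨c, hc.comp_tendsto ht⟩, -c, (hc.comp_tendsto ht').congr_left fun t => ?_⟩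
  have e : ((1 - t : ℝ) : ℂ) = -(t : ℂ) + 1 := by push_cast; ring
  rw [e, kroneckerCoeff_add_one, Function.comp_apply, div_neg, neg_div]

/-! ### Regularized elliptic multiple zeta values -/

theorem hasRegValue_truncatedIntegral (τ : ℍ) (k : List ℕ) :
    HasRegValue (truncatedIntegral τ k) (eMZV k τ) :=
  Classical.epsilon_spec (exists_hasRegValue_iterInt (continuousOn_kroneckerCoeff τ)
    (fun n => (exists_kroneckerCoeff_isBigO τ n).1)
    (fun n => (exists_kroneckerCoeff_isBigO τ n).2) k)

theorem eMZV_nil (τ : ℍ) : eMZV [] τ = 1 :=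
  (hasRegValue_truncatedIntegral τ []).unique (hasRegValue_const 1)

theorem eMZV_zero (τ : ℍ) : eMZV [0] τ = 1 := by
  refine (hasRegValue_truncatedIntegral τ [0]).unique
    ⟨Polynomial.C 1, 1, one_pos, by simp, IsBigO.of_bound 2 ?_⟩
  filter_upwards [Ioo_mem_nhdsGT (by norm_num : (0 : ℝ) < 1 / 2)] with ε hε
  have h : truncatedIntegral τ [0] ε = ∫ _ in ε..(1 - ε), (1 : ℂ) := by
    refine intervalIntegral.integral_congr fun t ht => ?_
    rw [Set.uIcc_of_le (by linarith [hε.2])] at ht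
    simp only [iterInt, mul_one]
    exact kroneckerCoeff_zero τ ⟨hε.1.trans_le ht.1, by linarith [ht.2, hε.1]⟩
  rw [h, intervalIntegral.integral_const, Polynomial.eval_C, Real.rpow_one]
  have e : ((1 - ε - ε) • (1 : ℂ) - 1) = ((-(2 * ε) : ℝ) : ℂ) := by
    rw [Complex.real_smul]
    push_cast
    ring
  rw [e, Complex.norm_real, norm_neg, norm_mul, Real.norm_two]

theorem eMZV_mul_eMZV (τ : ℍ) (k l : List ℕ) :
    eMZV k τ * eMZV l τ = ((shuffle k l).map fun m => eMZV m τ).sum := by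
  refine ((hasRegValue_truncatedIntegral τ k).mul (hasRegValue_truncatedIntegral τ l)).unique
    ((HasRegValue.list_sum (shuffle k l)
      fun m _ => hasRegValue_truncatedIntegral τ m).congr ?_)
  filter_upwards [Ioo_mem_nhdsGT (zero_lt_one (α := ℝ))] with ε hε
  exact (iterInt_mul_iterInt (continuousOn_kroneckerCoeff τ) hε
    ⟨by linarith [hε.2], by linarith [hε.1]⟩ k l).symm

end EllipticMZV

end

theorem mainTheorem1 :
    -- every truncated integral has the asymptotic expansion that defines its regularized value
    (∀ (τ : ℍ) (k : List ℕ),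
      EllipticMZV.HasRegValue (EllipticMZV.truncatedIntegral τ k) (EllipticMZV.eMZV k τ)) ∧
    -- the product of values is given by the shuffle product of indices
    (∀ (τ : ℍ) (k l : List ℕ), EllipticMZV.eMZV k τ * EllipticMZV.eMZV l τ =
      ((EllipticMZV.shuffle k l).map (fun m => EllipticMZV.eMZV m τ)).sum) ∧
    -- the equality of algebras, for the values as functions of `τ`
    (∃ E Eadm : Subalgebra ℚ (ℍ → ℂ),
      Subalgebra.toSubmodule E = EllipticMZV.spanAll EllipticMZV.eMZV ∧
      Subalgebra.toSubmodule Eadm = EllipticMZV.spanAdm EllipticMZV.eMZV ∧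
      E = (Algebra.adjoin Eadm
        (EllipticMZV.zeroOneValues EllipticMZV.eMZV)).restrictScalars ℚ) ∧
    -- the equality of algebras, for the values at a fixed `τ`
    (∀ τ : ℍ, ∃ E Eadm : Subalgebra ℚ ℂ,
      Subalgebra.toSubmodule E = EllipticMZV.spanAll (fun k => EllipticMZV.eMZV k τ) ∧
      Subalgebra.toSubmodule Eadm = EllipticMZV.spanAdm (fun k => EllipticMZV.eMZV k τ) ∧
      E = (Algebra.adjoin Eadm
        (EllipticMZV.zeroOneValues (fun k => EllipticMZV.eMZV k τ))).restrictScalars ℚ) := by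
  refine ⟨EllipticMZV.hasRegValue_truncatedIntegral, EllipticMZV.eMZV_mul_eMZV,
    EllipticMZV.exists_subalgebra_eq_adjoin (funext EllipticMZV.eMZV_nil)
      (funext EllipticMZV.eMZV_zero) fun k l => ?_,
    fun τ => EllipticMZV.exists_subalgebra_eq_adjoin (EllipticMZV.eMZV_nil τ)
      (EllipticMZV.eMZV_zero τ) (EllipticMZV.eMZV_mul_eMZV τ)⟩
  funext τ
  rw [Pi.mul_apply, EllipticMZV.eMZV_mul_eMZV, Pi.list_sum_apply, List.map_map]
  rfl
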